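/- **Setting.** Fix $d\ge 1$, $\mathfrak s\in[1,\infty)^d$, $\ell>0$ and a measurable $G:\mathbb R^d\to[0,\infty)$. Put $|\mathfrak s|=\sum_i\mathfrak s_i$, $\|x\|_{\mathfrak s}=\sum_i|x_i|^{1/\mathfrak s_i}$, $t^{\mathfrak s/\ell}x=(t^{\mathfrak s_i/\ell}x_i)_i$, $G_t(x)=t^{-|\mathfrak s|/\ell}G(t^{-\mathfrak s/\ell}x)$, $\varphi(x)=|x_1|^{1/\mathfrak s_1}\wedge 1$, $\varphi(x,y)=\varphi(x)\wedge\varphi(y)$, and $E=(\mathbb R\setminus\{0\})\times\mathbb R^{d-1}$. A $G$-controlled weight is a continuous $w:\mathbb R^d\to(0,1]$ with a continuous $w^*:\mathbb R^d\to[1,\infty)$ such that $w(x+y)\le w^*(x)w(y)$ and $\sup_{0<t\le T}\sup_x\|x\|_{\mathfrak s}^n\,w^*(t^{\mathfrak s/\ell}x)G(x)<\infty$ for all $n\in\mathbb N$, $T>0$. Let $w,v$ be $G$-controlled weights such that $wv$ is $G$-controlled with $(wv)^*=w^*v^*$. Let $\{Q_t\}_{t>0}$ be a $G$-type semigroup: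 continuous kernels $Q_t:\mathbb R^d\times\mathbb R^d\to\mathbb R$ with $\int Q_{t-s}(x,z)Q_s(z,y)\,dz=Q_t(x,y)$ for $0<s<t$, $\lim_{t\downarrow0}\int Q_t(x,y)\,dy=1$, $|Q_t(x,y)|\le C_1G_t(x-y)$, and $t\mapsto Q_t(x,y)$ differentiable with $|\partial_tQ_t(x,y)|\le C_2t^{-1}G_t(x-y)$. Write $Q_t(x,f)=\int Q_t(x,y)f(y)\,dy$. For a $G$-controlled weight $u$, $C(u)$ is the space of continuous $f$ with $\|fu\|_{L^\infty}<\infty$; for $\alpha\le0$, $C^{\alpha,Q}(u)$ is the completion of $C(u)$ under $\sup_{0<t\le1}t^{-\alpha/\ell}\|Q_tf\|_{L^\infty(u)}$, where $\|g\|_{L^\infty(u)}=\|gu\|_{L^\infty}$, and $Q_t(x,\cdot)$, $0<t\le 1$, is extended to it by continuity. Let $\mathscr T=(\mathbf A,\mathbf T,\mathbf G)$ be a regularity structure: $\mathbf A\subset\mathbb R$ is locally finite with smallest element $\alpha_0$, $\mathbf T=\bigoplus_{\alpha\in\mathbf A}\mathbf T_\alpha$ is an algebraic sum of Banach spaces,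 and $\mathbf G$ is a group of continuous linear operators $\Gamma$ on $\mathbf T$ with $(\Gamma-\mathrm{id})\mathbf T_\alpha\subset\mathbf T_{<\alpha}$; $\|\tau\|_\alpha$ is the norm of the $\mathbf T_\alpha$-component of $\tau$. Let $M=(\Pi,\Gamma)$ be a smooth model: continuous linear maps $\Pi_x:\mathbf T\to C(w)$ and $\Gamma_{xy}\in\mathbf G$ with $\Pi_x\Gamma_{xy}=\Pi_y$, $\Gamma_{xx}=\mathrm{id}$, $\Gamma_{xy}\Gamma_{yz}=\Gamma_{xz}$, such that for every $\gamma'\in\mathbb R$ there is $C$ with $$t^{-\alpha/\ell}w(x)|Q_t(x,\Pi_x\tau)|\le C\|\tau\|_\alpha,\qquad w(x)\|\Gamma_{yx}\tau\|_\beta\le C\,w^*(y-x)\|y-x\|_{\mathfrak s}^{\alpha-\beta}\|\tau\|_\alpha$$ for all $\beta<\alpha<\gamma'$ in $\mathbf A$ (in the first bound all $\alpha<\gamma'$ in $\mathbf A$), $\tau\in\mathbf T_\alpha$, $0<t\le1$ and $x\ne y$. Let $\gamma>0$, $\eta\in(\gamma-\mathfrak s_1,\gamma]$, and $f\in\mathcal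 D^{\gamma,\eta}_v(\Gamma)^\#$, that is, $f:E\to\mathbf T_{<\gamma}$ and for some $C$, all $\alpha<\gamma$ in $\mathbf A$ and all $x\neq y$ in $E$, $$v(x)\|f(x)\|_\alpha\le C\varphi(x)^{(\eta-\alpha)\wedge0},\qquad v(x)\|f(y)-\Gamma_{yx}f(x)\|_\alpha\le C\varphi(x,y)^{\eta-\gamma}v^*(x-y)\|y-x\|_{\mathfrak s}^{\gamma-\alpha}.$$ An element $\Lambda\in C^{\zeta,Q}(wv)$, $\zeta\le0$, is called a reconstruction of $f$ if $$\sup_{0<t\le1}\sup_{x\in E}t^{-\gamma/\ell}\varphi(x)^{\gamma-\eta}(wv)(x)\,|Q_t(x,\Lambda-\Pi_xf(x))|<\infty.$$ **Proposition.** Assume in addition that $\sup_{x\in\mathbb R^d}\sup_{\tau\in\mathbf T_\alpha\setminus\{0\}}w(x)|(\Pi_x\tau)(x)|/\|\tau\|_\alpha<\infty$ for every $\alpha\in\mathbf A$. Then the function $F(x)=(\Pi_xf(x))(x)$ is continuous on $E$, and the reconstruction of $f$ is realized as $F$: 1. for every $\zeta\le 0$, every reconstruction $\Lambda\in C^{\zeta,Q}(wv)$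 of $f$ equals $F$, in the sense that for all $t\in(0,1]$, $x\in\mathbb R^d$ the integral $\int Q_t(x,y)F(y)\,dy$ converges absolutely and equals $Q_t(x,\Lambda)$; moreover $\sup_{0<t\le1}t^{-(\eta\wedge\alpha_0\wedge0)/\ell}\|Q_t\Lambda\|_{L^\infty(wv)}<\infty$; 2. for every $\zeta<\eta\wedge0$ there exists exactly one reconstruction $\Lambda\in C^{\zeta,Q}(wv)$ of $f$. -/

import Mathlib

noncomputable section

namespace SingularMD

open MeasureTheory Set

/-- A point of `ℝ^d`; the coordinate `x 0` is the temporal variable. -/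
abbrev Pt (d : ℕ) : Type := Fin d → ℝ

/-- The fixed data: a scaling `s ∈ [1,∞)^d`, a number `ℓ > 0`, and a nonnegative measurable
function `G` on `ℝ^d`. -/
structure Setting (d : ℕ) where
  s : Fin d → ℝ
  one_le_s : ∀ i, 1 ≤ s i
  ℓ : ℝ
  ℓ_pos : 0 < ℓ
  G : Pt d → ℝ
  G_nonneg : ∀ x, 0 ≤ G x
  G_meas : Measurable G

namespace Setting

variable {d : ℕ} (S : Setting d)

/-- The anisotropic size `‖x‖_s = ∑ |x_i|^{1/s_i}`. -/
def anorm (x : Pt d) : ℝ := ∑ i, |x i| ^ (1 / S.s i)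

/-- The dilation `t^{s/ℓ} x`. -/
def dil (t : ℝ) (x : Pt d) : Pt d := fun i => t ^ (S.s i / S.ℓ) * x i

/-- The dilation `t^{-s/ℓ} x`. -/
def dilInv (t : ℝ) (x : Pt d) : Pt d := fun i => t ^ (-(S.s i / S.ℓ)) * x i

/-- `G_t(x) = t^{-|s|/ℓ} G(t^{-s/ℓ} x)`, with `|s| = ∑ s_i`. -/
def Gt (t : ℝ) (x : Pt d) : ℝ := t ^ (-((∑ i, S.s i) / S.ℓ)) * S.G (S.dilInv t x)

/-- The temporal weight `φ(x) = |x_1|^{1/s_1} ∧ 1`. -/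
def phi [NeZero d] (x : Pt d) : ℝ := min (|x 0| ^ (1 / S.s 0)) 1

/-- `φ(x,y) = φ(x) ∧ φ(y)`. -/
def phi₂ [NeZero d] (x y : Pt d) : ℝ := min (S.phi x) (S.phi y)

end Setting

/-- A `G`-controlled weight `w`, together with its majorant `w^*`, which enters the norms of models
and of modelled distributions. -/
structure GWeight {d : ℕ} (S : Setting d) where
  val : Pt d → ℝ
  star : Pt d → ℝ
  continuous_val : Continuous val
  val_pos : ∀ x, 0 < val x
  val_le_one : ∀ x, val x ≤ 1
  continuous_star : Continuous star
  one_le_star : ∀ x, 1 ≤ star x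
  moderate : ∀ x y, val (x + y) ≤ star x * val y
  integrable : ∀ (n : ℕ) (T : ℝ), 0 < T → ∃ C : ℝ, ∀ t ∈ Ioc (0 : ℝ) T, ∀ x,
    S.anorm x ^ n * star (S.dil t x) * S.G x ≤ C

/-- A `G`-type semigroup `{Q_t(x,y)}_{t>0}`; only the values at `t > 0` matter. -/
structure GSemigroup {d : ℕ} (S : Setting d) where
  Q : ℝ → Pt d → Pt d → ℝ
  continuous_Q : ∀ t, 0 < t → Continuous (fun p : Pt d × Pt d => Q t p.1 p.2)
  semigroup : ∀ s t, 0 < s → s < t → ∀ x y, ∫ z, Q (t - s) x z * Q s z y = Q t x y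
  conservative : ∀ x, Filter.Tendsto (fun t => ∫ y, Q t x y) (nhdsWithin 0 (Ioi 0)) (nhds 1)
  upper : ∃ C : ℝ, 0 < C ∧ ∀ t, 0 < t → ∀ x y, |Q t x y| ≤ C * S.Gt t (x - y)
  differentiable : ∀ t, 0 < t → ∀ x y, DifferentiableAt ℝ (fun r => Q r x y) t
  deriv_bound : ∃ C : ℝ, 0 < C ∧ ∀ t, 0 < t → ∀ x y,
    |deriv (fun r => Q r x y) t| ≤ C * t⁻¹ * S.Gt t (x - y)

/-- The integral `Q_t(x,f) = (Q_t f)(x) = ∫ Q_t(x,y) f(y) dy`. -/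
def GSemigroup.act {d : ℕ} {S : Setting d} (Q : GSemigroup S) (t : ℝ) (x : Pt d)
    (f : Pt d → ℝ) : ℝ := ∫ y, Q.Q t x y * f y

/-- The space `C(w)` of continuous functions `f` such that `f w` is bounded. -/
def CW {d : ℕ} {S : Setting d} (w : GWeight S) : Submodule ℝ (Pt d → ℝ) where
  carrier := {f | Continuous f ∧ ∃ C : ℝ, ∀ x, w.val x * |f x| ≤ C}
  zero_mem' := ⟨continuous_const, 0, fun x => by simp⟩
  add_mem' := by
    rintro f g ⟨hf, C, hC⟩ ⟨hg, D, hD⟩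
    refine ⟨hf.add hg, C + D, fun x => ?_⟩
    have h1 := mul_le_mul_of_nonneg_left (abs_add_le (f x) (g x)) (w.val_pos x).le
    have h2 := hC x
    have h3 := hD x
    rw [mul_add] at h1
    simpa using h1.trans (add_le_add h2 h3)
  smul_mem' := by
    rintro c f ⟨hf, C, hC⟩
    refine ⟨continuous_const.mul hf, |c| * C, fun x => ?_⟩
    have h := mul_le_mul_of_nonneg_left (hC x) (abs_nonneg c)
    calc w.val x * |(c • f) x| = |c| * (w.val x * |f x|) := by
          simp [abs_mul]; ring
      _ ≤ |c| * C := h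

/-! ### Boundedness of `Q_t` on `C(w)`, needed to make sense of the Besov norm -/

section Bounds

variable {d : ℕ} {S : Setting d}

lemma GWeight.exists_prod_bound (w : GWeight S) :
    ∃ B : ℝ, 0 ≤ B ∧ ∀ t ∈ Ioc (0 : ℝ) 1, ∀ x : Pt d,
      w.star (S.dil t x) * S.G x ≤ B * ∏ i, (1 + x i ^ 2)⁻¹ := by
  obtain ⟨m, hm⟩ : ∃ m : ℕ, ∀ i, 2 * S.s i ≤ m := by
    obtain ⟨m, hm⟩ := exists_nat_ge (∑ i, 2 * S.s i)
    refine ⟨m, fun i => le_trans ?_ hm⟩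
    exact Finset.single_le_sum (f := fun i => 2 * S.s i)
      (fun j _ => by have := S.one_le_s j; linarith) (Finset.mem_univ i)
  obtain ⟨C₀, h₀⟩ := w.integrable 0 1 one_pos
  obtain ⟨C₁, h₁⟩ := w.integrable (m * d) 1 one_pos
  refine ⟨max (4 ^ d * (C₀ + C₁)) 0, le_max_right _ _, fun t ht x => ?_⟩
  set r := S.anorm x with hr
  have hr0 : 0 ≤ r := Finset.sum_nonneg fun i _ => Real.rpow_nonneg (abs_nonneg _) _
  have hcoord : ∀ i, 1 + x i ^ 2 ≤ 2 * (1 + r ^ m) := by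
    intro i
    have hs := S.one_le_s i
    have h1 : |x i| ^ (1 / S.s i) ≤ r :=
      Finset.single_le_sum (f := fun i => |x i| ^ (1 / S.s i))
        (fun j _ => Real.rpow_nonneg (abs_nonneg _) _) (Finset.mem_univ i)
    have h2 : |x i| ^ 2 ≤ r ^ (2 * S.s i) := by
      have := Real.rpow_le_rpow (Real.rpow_nonneg (abs_nonneg _) _) h1
        (by linarith : (0 : ℝ) ≤ 2 * S.s i)
      rw [← Real.rpow_mul (abs_nonneg _)] at this
      have e : 1 / S.s i * (2 * S.s i) = (2 : ℕ) := by
        have : S.s i ≠ 0 := by linarith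
        field_simp
        norm_num
      rwa [e, Real.rpow_natCast] at this
    have h3 : r ^ (2 * S.s i) ≤ 1 + r ^ m := by
      rcases le_total r 1 with h | h
      · have := Real.rpow_le_one hr0 h (by linarith : (0 : ℝ) ≤ 2 * S.s i)
        have := pow_nonneg hr0 m
        linarith
      · have := Real.rpow_le_rpow_of_exponent_le h (hm i)
        rw [Real.rpow_natCast] at this
        linarith
    rw [sq_abs] at h2
    have := pow_nonneg hr0 m
    linarith
  have hprod : ∏ i, (1 + x i ^ 2) ≤ 4 ^ d * (1 + r ^ (m * d)) := by
    calc ∏ i, (1 + x i ^ 2) ≤ ∏ _i : Fin d, (2 * (1 + r ^ m)) :=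
          Finset.prod_le_prod (fun i _ => by positivity) fun i _ => hcoord i
      _ = 2 ^ d * (1 + r ^ m) ^ d := by simp [mul_pow]
      _ ≤ 2 ^ d * (2 ^ d * (1 ^ d + (r ^ m) ^ d)) := by
          gcongr
          refine (add_pow_le zero_le_one (pow_nonneg hr0 m) d).trans ?_
          gcongr
          · norm_num
          · omega
      _ = 4 ^ d * (1 + r ^ (m * d)) := by
          rw [one_pow, ← pow_mul, ← mul_assoc, ← mul_pow]; norm_num
  have hP : 0 < ∏ i, (1 + x i ^ 2) := Finset.prod_pos fun i _ => by positivity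
  have hsG : 0 ≤ w.star (S.dil t x) * S.G x :=
    mul_nonneg (zero_le_one.trans (w.one_le_star _)) (S.G_nonneg x)
  rw [Finset.prod_inv_distrib, ← div_eq_mul_inv, le_div_iff₀ hP]
  refine le_trans ?_ (le_max_left _ _)
  have a0 := h₀ t ht x
  have a1 := h₁ t ht x
  calc w.star (S.dil t x) * S.G x * ∏ i, (1 + x i ^ 2)
      ≤ w.star (S.dil t x) * S.G x * (4 ^ d * (1 + r ^ (m * d))) := by gcongr
    _ = 4 ^ d * (r ^ 0 * w.star (S.dil t x) * S.G x
          + r ^ (m * d) * w.star (S.dil t x) * S.G x) := by ring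
    _ ≤ 4 ^ d * (C₀ + C₁) := by gcongr

/-- `w(x) |Q_t(x,y) f(y)|` is dominated by an integrable function of `y` whose integral does not
depend on `x` and `t ∈ (0,1]`. -/
lemma GSemigroup.exists_dominated (Q : GSemigroup S) (w : GWeight S) :
    ∃ K : ℝ, 0 ≤ K ∧ ∀ t ∈ Ioc (0 : ℝ) 1, ∀ x : Pt d, ∃ g : Pt d → ℝ,
      Integrable g ∧ ∫ y, g y = K ∧
      ∀ (f : Pt d → ℝ) (M : ℝ), (∀ y, w.val y * |f y| ≤ M) →
        ∀ y, w.val x * |Q.Q t x y * f y| ≤ M * g y := by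
  obtain ⟨B, hB0, hB⟩ := w.exists_prod_bound
  obtain ⟨C, hC0, hC⟩ := Q.upper
  refine ⟨C * B * ∏ _i : Fin d, ∫ u : ℝ, (1 + u ^ 2)⁻¹, ?_, fun t ht x => ?_⟩
  · refine mul_nonneg (by positivity) (Finset.prod_nonneg fun i _ => ?_)
    exact integral_nonneg fun u => by positivity
  have ht0 : 0 < t := ht.1
  set c : Fin d → ℝ := fun i => t ^ (-(S.s i / S.ℓ)) with hc
  have hcpos : ∀ i, 0 < c i := fun i => Real.rpow_pos_of_pos ht0 _
  set k : Fin d → ℝ → ℝ := fun i u => c i * (1 + (c i * u) ^ 2)⁻¹ with hk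
  have hkint : ∀ i, Integrable (k i) := fun i =>
    ((integrable_inv_one_add_sq).comp_mul_left' (hcpos i).ne').const_mul (c i)
  have hkval : ∀ i, ∫ u, k i u = ∫ u : ℝ, (1 + u ^ 2)⁻¹ := by
    intro i
    simp only [hk]
    rw [integral_const_mul, Measure.integral_comp_mul_left (fun u : ℝ => (1 + u ^ 2)⁻¹),
      abs_of_pos (inv_pos.2 (hcpos i)), smul_eq_mul, ← mul_assoc, mul_inv_cancel₀ (hcpos i).ne',
      one_mul]
  have hint : Integrable (fun z : Pt d => ∏ i, k i (z i)) :=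
    Integrable.fintype_prod (f := k) hkint
  have hval : ∫ z : Pt d, ∏ i, k i (z i) = ∏ _i : Fin d, ∫ u : ℝ, (1 + u ^ 2)⁻¹ := by
    rw [integral_fintype_prod_volume_eq_prod]
    exact Finset.prod_congr rfl fun i _ => hkval i
  refine ⟨fun y => C * B * ∏ i, k i ((x - y) i), ?_, ?_, ?_⟩
  · exact (hint.comp_sub_left x).const_mul (C * B)
  · rw [integral_const_mul, integral_sub_left_eq_self (fun z : Pt d => ∏ i, k i (z i)), hval]
  · intro f M hM y
    have hz : S.dil t (S.dilInv t (x - y)) = x - y := by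
      funext i
      simp only [Setting.dil, Setting.dilInv]
      rw [← mul_assoc, ← Real.rpow_add ht0, add_neg_cancel, Real.rpow_zero, one_mul]
    have hb := hB t ht (S.dilInv t (x - y))
    rw [hz] at hb
    have hGt : S.Gt t (x - y) * w.star (x - y) ≤ B * ∏ i, k i ((x - y) i) := by
      have hpre : t ^ (-((∑ i, S.s i) / S.ℓ)) = ∏ i, c i := by
        simp only [hc]
        rw [← Real.rpow_sum_of_pos ht0, Finset.sum_neg_distrib, Finset.sum_div]
      have hp : 0 ≤ ∏ i, c i := Finset.prod_nonneg fun i _ => (hcpos i).le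
      calc S.Gt t (x - y) * w.star (x - y)
          = (∏ i, c i) * (w.star (x - y) * S.G (S.dilInv t (x - y))) := by
            rw [Setting.Gt, hpre]; ring
        _ ≤ (∏ i, c i) * (B * ∏ i, (1 + (S.dilInv t (x - y)) i ^ 2)⁻¹) := by gcongr
        _ = B * ∏ i, k i ((x - y) i) := by
            simp only [hk, Finset.prod_mul_distrib, Setting.dilInv, hc]; ring
    have hM0 : 0 ≤ M := le_trans (mul_nonneg (w.val_pos y).le (abs_nonneg _)) (hM y)
    have hw : w.val x ≤ w.star (x - y) * w.val y := by
      have := w.moderate (x - y) y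
      rwa [sub_add_cancel] at this
    have hG0 : 0 ≤ S.Gt t (x - y) :=
      mul_nonneg (Real.rpow_nonneg ht0.le _) (S.G_nonneg _)
    have hs0 : 0 ≤ w.star (x - y) := zero_le_one.trans (w.one_le_star _)
    calc w.val x * |Q.Q t x y * f y|
        = w.val x * (|Q.Q t x y| * |f y|) := by rw [abs_mul]
      _ ≤ (w.star (x - y) * w.val y) * ((C * S.Gt t (x - y)) * |f y|) := by
          have h1 := w.val_pos y
          have h2 := w.val_pos x
          gcongr
          exact hC t ht0 x y
      _ = C * (S.Gt t (x - y) * w.star (x - y)) * (w.val y * |f y|) := by ring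
      _ ≤ C * (B * ∏ i, k i ((x - y) i)) * M := by
          have h1 := w.val_pos y
          have h3 : 0 ≤ B * ∏ i, k i ((x - y) i) := le_trans (mul_nonneg hG0 hs0) hGt
          gcongr
          exact hM y
      _ = M * (C * B * ∏ i, k i ((x - y) i)) := by ring

lemma GSemigroup.integrable_act (Q : GSemigroup S) (w : GWeight S) {t : ℝ} (ht : t ∈ Ioc (0 : ℝ) 1)
    (x : Pt d) (f : CW w) : Integrable (fun y => Q.Q t x y * (f : Pt d → ℝ) y) := by
  obtain ⟨K, -, hK⟩ := Q.exists_dominated w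
  obtain ⟨g, hg, -, hdom⟩ := hK t ht x
  obtain ⟨hf, M, hM⟩ := f.2
  have hcont : Continuous (fun y => Q.Q t x y * (f : Pt d → ℝ) y) :=
    ((Q.continuous_Q t ht.1).comp (continuous_const.prodMk continuous_id)).mul hf
  refine (hg.const_mul ((w.val x)⁻¹ * M)).mono' hcont.aestronglyMeasurable
    (Filter.Eventually.of_forall fun y => ?_)
  have := hdom f M hM y
  rw [Real.norm_eq_abs, mul_assoc, ← div_eq_inv_mul, le_div_iff₀ (w.val_pos x), mul_comm]
  exact this

lemma GSemigroup.exists_act_bound (Q : GSemigroup S) (w : GWeight S) (f : CW w) :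
    ∃ C : ℝ, ∀ t ∈ Ioc (0 : ℝ) 1, ∀ x, w.val x * |Q.act t x f| ≤ C := by
  obtain ⟨K, -, hK⟩ := Q.exists_dominated w
  obtain ⟨hf, M, hM⟩ := f.2
  refine ⟨M * K, fun t ht x => ?_⟩
  obtain ⟨g, hg, hgK, hdom⟩ := hK t ht x
  have hi := (Q.integrable_act w ht x f).abs
  calc w.val x * |Q.act t x f|
      ≤ w.val x * ∫ y, |Q.Q t x y * (f : Pt d → ℝ) y| := by
        gcongr
        · exact (w.val_pos x).le
        · exact abs_integral_le_integral_abs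
    _ = ∫ y, w.val x * |Q.Q t x y * (f : Pt d → ℝ) y| := (integral_const_mul _ _).symm
    _ ≤ ∫ y, M * g y := integral_mono (hi.const_mul _) (hg.const_mul M) fun y => hdom f M hM y
    _ = M * K := by rw [integral_const_mul, hgK]

end Bounds

/-! ### The Besov space `C^{α,Q}(w)`, `α ≤ 0` -/

section Besov

variable {d : ℕ} {S : Setting d}

/-- The space `C(w)`, to be equipped with the norm of `C^{α,Q}(w)`. -/
def BesovPre (_Q : GSemigroup S) (w : GWeight S) (_α : Iic (0 : ℝ)) : Type := CW w

variable (Q : GSemigroup S) (w : GWeight S) (α : Iic (0 : ℝ))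

instance : AddCommGroup (BesovPre Q w α) := inferInstanceAs (AddCommGroup (CW w))

/-- The function on `ℝ^d` underlying an element of `C(w)`. -/
def BesovPre.fn {Q : GSemigroup S} {w : GWeight S} {α : Iic (0 : ℝ)} (f : BesovPre Q w α) :
    Pt d → ℝ := Subtype.val (p := fun g => g ∈ CW w) f

/-- `‖f‖_{C^{α,Q}(w)} = sup_{0<t≤1} t^{-α/ℓ} sup_x w(x) |(Q_t f)(x)|`. Since `Q_t f` is continuous,
the inner supremum is the `L^∞(w)` norm. -/
def besovNorm (f : BesovPre Q w α) : ℝ :=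
  ⨆ p : Ioc (0 : ℝ) 1 × Pt d,
    (p.1 : ℝ) ^ (-(α : ℝ) / S.ℓ) * (w.val p.2 * |Q.act (p.1 : ℝ) p.2 f.fn|)

lemma besovNorm_bddAbove (f : BesovPre Q w α) :
    BddAbove (range fun p : Ioc (0 : ℝ) 1 × Pt d =>
      (p.1 : ℝ) ^ (-(α : ℝ) / S.ℓ) * (w.val p.2 * |Q.act (p.1 : ℝ) p.2 f.fn|)) := by
  obtain ⟨C, hC⟩ := Q.exists_act_bound w f
  refine ⟨C, ?_⟩
  rintro _ ⟨⟨t, x⟩, rfl⟩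
  have h1 : (t : ℝ) ^ (-(α : ℝ) / S.ℓ) ≤ 1 := by
    have : (α : ℝ) ≤ 0 := α.2
    exact Real.rpow_le_one t.2.1.le t.2.2 (div_nonneg (by linarith) S.ℓ_pos.le)
  have h2 : 0 ≤ w.val x * |Q.act (t : ℝ) x f.fn| :=
    mul_nonneg (w.val_pos x).le (abs_nonneg _)
  exact (mul_le_of_le_one_left h2 h1).trans (hC t t.2 x)

lemma act_add {t : ℝ} (ht : t ∈ Ioc (0 : ℝ) 1) (x : Pt d) (f g : BesovPre Q w α) :
    Q.act t x (f + g).fn = Q.act t x f.fn + Q.act t x g.fn := by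
  have h := integral_add (Q.integrable_act w ht x f) (Q.integrable_act w ht x g)
  unfold GSemigroup.act
  refine Eq.trans (integral_congr_ae (Filter.Eventually.of_forall fun y => ?_)) h
  exact mul_add (Q.Q t x y) (f.fn y) (g.fn y)

lemma act_neg (t : ℝ) (x : Pt d) (f : BesovPre Q w α) :
    Q.act t x (-f).fn = -Q.act t x f.fn := by
  unfold GSemigroup.act
  rw [← integral_neg]
  exact integral_congr_ae (Filter.Eventually.of_forall fun y => mul_neg (Q.Q t x y) (f.fn y))

/-- `‖·‖_{C^{α,Q}(w)}` on `C(w)`. -/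
def besovSeminorm : AddGroupSeminorm (BesovPre Q w α) where
  toFun := besovNorm Q w α
  map_zero' := by
    have h : ∀ p : Ioc (0 : ℝ) 1 × Pt d, (p.1 : ℝ) ^ (-(α : ℝ) / S.ℓ) *
        (w.val p.2 * |Q.act (p.1 : ℝ) p.2 (0 : BesovPre Q w α).fn|) = 0 := by
      intro p
      have : Q.act (p.1 : ℝ) p.2 (0 : BesovPre Q w α).fn = 0 := by
        have h0 : (0 : BesovPre Q w α).fn = fun _ => 0 := rfl
        simp [GSemigroup.act, h0]
      simp [this]
    simp only [besovNorm, h, Real.iSup_const_zero]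
  add_le' f g := by
    have : Nonempty (Ioc (0 : ℝ) 1 × Pt d) := ⟨⟨⟨1, by norm_num⟩, 0⟩⟩
    refine ciSup_le fun p => ?_
    have h1 := le_ciSup (besovNorm_bddAbove Q w α f) p
    have h2 := le_ciSup (besovNorm_bddAbove Q w α g) p
    refine le_trans ?_ (add_le_add h1 h2)
    rw [act_add Q w α p.1.2, ← mul_add, ← mul_add]
    have := w.val_pos p.2
    have := Real.rpow_nonneg p.1.2.1.le (-(α : ℝ) / S.ℓ)
    gcongr
    exact abs_add_le _ _
  neg' f := by simp only [besovNorm, act_neg, abs_neg]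

instance : SeminormedAddCommGroup (BesovPre Q w α) :=
  (besovSeminorm Q w α).toSeminormedAddCommGroup

/-- The Besov space `C^{α,Q}(w)`, `α ≤ 0`: the completion of `C(w)` under the norm
`‖·‖_{C^{α,Q}(w)}`. -/
abbrev Besov : Type := UniformSpace.Completion (BesovPre Q w α)

/-- The continuous extension `Λ ↦ Q_t(x,Λ) = (Q_t Λ)(x)` to `C^{α,Q}(w)` of the functional
`f ↦ Q_t(x,f)` on `C(w)`, for `t ∈ (0,1]`. -/
def Besov.act {Q : GSemigroup S} {w : GWeight S} {α : Iic (0 : ℝ)} (t : ℝ) (x : Pt d)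
    (Λ : Besov Q w α) : ℝ :=
  UniformSpace.Completion.extension (fun f : BesovPre Q w α => Q.act t x f.fn) Λ

lemma uniformContinuous_act {t : ℝ} (ht : t ∈ Ioc (0 : ℝ) 1) (x : Pt d) :
    UniformContinuous (fun f : BesovPre Q w α => Q.act t x f.fn) := by
  set c : ℝ := t ^ (-(α : ℝ) / S.ℓ) * w.val x with hc
  have hcpos : 0 < c := mul_pos (Real.rpow_pos_of_pos ht.1 _) (w.val_pos x)
  refine (LipschitzWith.of_dist_le_mul (K := Real.toNNReal c⁻¹) fun f g => ?_)
    |>.uniformContinuous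
  have h := le_ciSup (besovNorm_bddAbove Q w α (f - g)) ⟨⟨t, ht⟩, x⟩
  have hsub : Q.act t x (f - g).fn = Q.act t x f.fn - Q.act t x g.fn := by
    rw [sub_eq_add_neg, act_add Q w α ht, act_neg, sub_eq_add_neg]
  have h' : c * |Q.act t x (f - g).fn| ≤ ‖f - g‖ := by
    refine le_trans (le_of_eq ?_) h
    simp only [hc]; ring
  rw [Real.dist_eq, dist_eq_norm, ← hsub, Real.coe_toNNReal _ (inv_pos.2 hcpos).le, ← div_eq_inv_mul, le_div_iff₀ hcpos,
    mul_comm]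
  exact h'

lemma Besov.act_coe {t : ℝ} (ht : t ∈ Ioc (0 : ℝ) 1) (x : Pt d) (f : BesovPre Q w α) :
    Besov.act t x (f : Besov Q w α) = Q.act t x f.fn :=
  UniformSpace.Completion.extension_coe (uniformContinuous_act Q w α ht x) f

end Besov

/-! ### Regularity structures, smooth models, singular modelled distributions -/

/-- A regularity structure. The model space `⨁ T_α` carries the direct sum topology, for which a
linear map is continuous iff its restriction to each `T_α` is; since `Γ T_α` lies in the finite sum
of the `T_β` with `β ≤ α`, this is componentwise continuity for `Γ ∈ grp`. -/
structure RegularityStructure where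
  A : Set ℝ
  locallyFinite : ∀ a b : ℝ, (A ∩ Icc a b).Finite
  /-- The regularity `α₀`, i.e. the smallest element of `A`. -/
  α₀ : ℝ
  isLeast : IsLeast A α₀
  T : A → Type*
  [normed : ∀ α, NormedAddCommGroup (T α)]
  [space : ∀ α, NormedSpace ℝ (T α)]
  [complete : ∀ α, CompleteSpace (T α)]
  grp : Subgroup ((DirectSum A T) ≃ₗ[ℝ] (DirectSum A T))
  continuous_grp : ∀ Γ ∈ grp, ∀ α β : A, Continuous fun τ : T α => (Γ (DirectSum.lof ℝ A T α τ)) β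
  triangular : ∀ Γ ∈ grp, ∀ α β : A, α ≤ β → ∀ τ : T α,
    (Γ (DirectSum.lof ℝ A T α τ) - DirectSum.lof ℝ A T α τ) β = 0

attribute [instance] RegularityStructure.normed RegularityStructure.space
  RegularityStructure.complete

/-- The model space `⨁_{α ∈ A} T_α`. -/
abbrev RegularityStructure.Mod (R : RegularityStructure) : Type _ := DirectSum R.A R.T

/-- The inclusion `T_α → ⨁ T_α`. -/
abbrev RegularityStructure.incl (R : RegularityStructure) (α : R.A) : R.T α →ₗ[ℝ] R.Mod :=
  DirectSum.lof ℝ R.A R.T α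

/-- A smooth model `(Π,Γ)`. -/
structure SmoothModel {d : ℕ} {S : Setting d} (Q : GSemigroup S) (w : GWeight S)
    (R : RegularityStructure) where
  Pi : Pt d → R.Mod →ₗ[ℝ] CW w
  /-- Continuity of `Π_x` on each `T_α`, where `C(w)` has the `L^∞(w)` norm. -/
  continuous_Pi : ∀ x (α : R.A), ∃ C : ℝ, ∀ (τ : R.T α) y,
    w.val y * |(Pi x (R.incl α τ) : Pt d → ℝ) y| ≤ C * ‖τ‖
  Γ : Pt d → Pt d → (R.Mod ≃ₗ[ℝ] R.Mod)
  Γ_mem : ∀ x y, Γ x y ∈ R.grp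
  Pi_Γ : ∀ x y τ, Pi x (Γ x y τ) = Pi y τ
  Γ_self : ∀ x τ, Γ x x τ = τ
  Γ_comp : ∀ x y z τ, Γ x y (Γ y z τ) = Γ x z τ
  Pi_bound : ∀ γ : ℝ, ∃ C : ℝ, ∀ α : R.A, (α : ℝ) < γ → ∀ t ∈ Ioc (0 : ℝ) 1, ∀ x (τ : R.T α),
    t ^ (-(α : ℝ) / S.ℓ) * w.val x * |Q.act t x (Pi x (R.incl α τ))| ≤ C * ‖τ‖
  Γ_bound : ∀ γ : ℝ, ∃ C : ℝ, ∀ α β : R.A, β < α → (α : ℝ) < γ → ∀ x y, x ≠ y → ∀ τ : R.T α,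
    w.val x * ‖(Γ y x (R.incl α τ)) β‖
      ≤ C * (w.star (y - x) * S.anorm (y - x) ^ ((α : ℝ) - β) * ‖τ‖)

section Distributions

variable {d : ℕ} [NeZero d] {S : Setting d} {Q : GSemigroup S} {w : GWeight S}
  {R : RegularityStructure}

/-- Membership `f ∈ D_v^{γ,η}(Γ)^#`. The function `f` lives on `{x_1 ≠ 0}`; its values elsewhere are
never used. -/
structure MemDSharp (v : GWeight S) (M : SmoothModel Q w R) (γ η : ℝ) (f : Pt d → R.Mod) :
    Prop where
  /-- `f` takes values in `T_{<γ}`. -/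
  mem_lt : ∀ x, x 0 ≠ 0 → ∀ α : R.A, γ ≤ α → f x α = 0
  bound : ∃ C : ℝ, ∀ α : R.A, (α : ℝ) < γ → ∀ x, x 0 ≠ 0 →
    v.val x * ‖f x α‖ ≤ C * S.phi x ^ (min (η - α) 0)
  bound_diff : ∃ C : ℝ, ∀ α : R.A, (α : ℝ) < γ → ∀ x y, x 0 ≠ 0 → y 0 ≠ 0 → x ≠ y →
    v.val x * ‖(f y - M.Γ y x (f x)) α‖
      ≤ C * (S.phi₂ x y ^ (η - γ) * v.star (x - y) * S.anorm (y - x) ^ (γ - α))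

/-- `Λ ∈ C^{ζ,Q}(u)`, where `u = w v`, is a reconstruction of `f` for the smooth model `M`:
with `Λ_x = Λ - Π_x f(x)`, so that `Q_t(x,Λ_x) = Q_t(x,Λ) - Q_t(x,Π_x f(x))`,
`sup_{0<t≤1} sup_{x_1≠0} t^{-γ/ℓ} φ(x)^{γ-η} u(x) |Q_t(x,Λ_x)| < ∞`. -/
def IsReconstruction (M : SmoothModel Q w R) (γ η : ℝ) (f : Pt d → R.Mod)
    {u : GWeight S} {ζ : Iic (0 : ℝ)} (Λ : Besov Q u ζ) : Prop :=
  ∃ C : ℝ, ∀ t ∈ Ioc (0 : ℝ) 1, ∀ x : Pt d, x 0 ≠ 0 →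
    t ^ (-γ / S.ℓ) * S.phi x ^ (γ - η) * u.val x *
      |Besov.act t x Λ - Q.act t x (M.Pi x (f x))| ≤ C

/-- The element `Λ` of `C^{ζ,Q}(u)` is (given by) the function `F`: `Q_t(x,F)` converges absolutely
and `Q_t(x,Λ) = Q_t(x,F)`. An element of `C^{ζ,Q}(u)` is determined by these numbers. -/
def IsRealizedBy {u : GWeight S} {ζ : Iic (0 : ℝ)} (Λ : Besov Q u ζ) (F : Pt d → ℝ) : Prop :=
  ∀ t ∈ Ioc (0 : ℝ) 1, ∀ x : Pt d,
    Integrable (fun y => Q.Q t x y * F y) ∧ Besov.act t x Λ = Q.act t x F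

end Distributions

end SingularMD

end

open SingularMD

/-! The key fact is that `(Π_x τ)(x) = 0` for `τ` of positive degree: `Q_t(x, Π_x τ)` is
`O(t^{α/ℓ})` and also tends to `(Π_x τ)(x)` as `t ↓ 0`. So `F(x) = (Π_x f(x))(x)` sees only the
finitely many components of degree `α ≤ 0`, which the extra assumption bounds on the diagonal. Two
estimates follow. First, `wv |F| ≲ φ^{η ∧ 0}`. Second, `F(y) - (Π_x f(x))(y) = (Π_y (f(y) - Γ_{yx}
f(x)))(y)` is bounded by `φ(x,y)^{η-γ}` times powers `‖x-y‖_s^{γ-α}` with `γ - α ≥ γ > 0`. The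
second gives continuity of `F` and, integrated against `Q_t`, the reconstruction bound for `F`
itself.

To integrate such bounds, `G_t`, with weights and moments, is dominated by a product of Cauchy
kernels (`GWeight.exists_Gt_bound`). Since `φ` depends on one coordinate, convolution with `φ^{-a}`
is a one-dimensional computation, valid for `a < s_1` (`Setting.kern_conv_phi`). Both `a = -(η ∧ 0)`
and `a = γ - η` qualify because `η > γ - s_1` and `γ > 0`.

Uniqueness (`isRealizedBy_of_asymptotic`): if `Λ` is a reconstruction, `Q_s(Λ - F)` is `O(s^{γ/ℓ})
φ^{η-γ}`. Applying `Q_{t-s}` and letting `s ↓ 0` gives `Q_t Λ = Q_t F`, whatever `ζ` is. Existence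
(`exists_isRealizedBy`): cutting `F` off near the hyperplane `x_1 = 0` gives elements of `C(wv)`
that form a Cauchy sequence in `C^{ζ,Q}(wv)` when `ζ < η ∧ 0`. -/

namespace SingularMD

open MeasureTheory Set Filter Topology

/-! ### The one-dimensional Cauchy kernel -/

/-- The Cauchy kernel `c / (1 + (c u)²)`. -/
noncomputable def cauchyKernel (c u : ℝ) : ℝ := c * (1 + (c * u) ^ 2)⁻¹

lemma cauchyKernel_nonneg {c : ℝ} (hc : 0 < c) (u : ℝ) : 0 ≤ cauchyKernel c u := by
  unfold cauchyKernel; positivity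

lemma integrable_cauchyKernel {c : ℝ} (hc : 0 < c) : Integrable (cauchyKernel c) :=
  ((integrable_inv_one_add_sq).comp_mul_left' hc.ne').const_mul c

lemma integral_cauchyKernel {c : ℝ} (hc : 0 < c) : ∫ u, cauchyKernel c u = Real.pi := by
  simp only [cauchyKernel]
  rw [integral_const_mul, Measure.integral_comp_mul_left (fun u : ℝ => (1 + u ^ 2)⁻¹),
    abs_of_pos (inv_pos.2 hc), smul_eq_mul, ← mul_assoc, mul_inv_cancel₀ hc.ne',
    one_mul, integral_univ_inv_one_add_sq]

lemma cauchyKernel_le {c : ℝ} (hc : 0 < c) (u : ℝ) : cauchyKernel c u ≤ c := by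
  unfold cauchyKernel
  exact mul_le_of_le_one_right hc.le (inv_le_one_of_one_le₀ (by nlinarith [sq_nonneg (c * u)]))

/-- Uniform in `c`, because `c r ≤ 1 + (c r)²`. This uniformity is the source of the bounds by
`φ(x)` that do not degenerate as `t ↓ 0`. -/
lemma cauchyKernel_le_inv {c r u : ℝ} (hc : 0 < c) (hr : 0 < r) (hu : r ≤ |u|) :
    cauchyKernel c u ≤ r⁻¹ := by
  unfold cauchyKernel
  rw [← div_eq_mul_inv, div_le_iff₀ (by positivity), ← div_eq_inv_mul, le_div_iff₀ hr]
  have h : r ^ 2 ≤ u ^ 2 := by rw [← sq_abs u]; gcongr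
  have h' : c ^ 2 * r ^ 2 ≤ c ^ 2 * u ^ 2 := by gcongr
  nlinarith [sq_nonneg (c * r - 1)]

lemma measurable_cauchyKernel (c : ℝ) : Measurable (cauchyKernel c) := by
  unfold cauchyKernel; fun_prop

/-- Split at `|y| = r`. Inside, the kernel is at most `r⁻¹` and `|y|^{-b}` is integrable; outside,
`|y|^{-b} ≤ r^{-b}` and the kernel has mass `π`. The scale `r` is free so that it can be adapted
either to the kernel or to the point `x`. -/
lemma cauchyKernel_conv_rpow {b c r x : ℝ} (hb : 0 ≤ b) (hb1 : b < 1) (hc : 0 < c) (hr : 0 < r)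
    (hk : ∀ y, |y| < r → cauchyKernel c (x - y) ≤ r⁻¹) :
    Integrable (fun y => cauchyKernel c (x - y) * |y| ^ (-b)) ∧
      ∫ y, cauchyKernel c (x - y) * |y| ^ (-b) ≤ (2 / (1 - b) + Real.pi) * r ^ (-b) := by
  set f : ℝ → ℝ := (Ioc 0 r).indicator fun y => y ^ (-b) with hf
  have hfon : IntegrableOn (fun y : ℝ => y ^ (-b)) (Ioc 0 r) :=
    (intervalIntegrable_iff_integrableOn_Ioc_of_le hr.le).1
      (intervalIntegral.intervalIntegrable_rpow' (by linarith))
  have hfi : Integrable f := (integrable_indicator_iff measurableSet_Ioc).2 hfon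
  have hfv : ∫ y, f y = r ^ (1 - b) / (1 - b) := by
    rw [hf, integral_indicator measurableSet_Ioc, ← intervalIntegral.integral_of_le hr.le,
      integral_rpow (Or.inl (by linarith)), Real.zero_rpow (by linarith), sub_zero]
    congr 1 <;> ring_nf
  have hf0 : ∀ y, 0 ≤ f y := fun y =>
    indicator_nonneg (fun y hy => Real.rpow_nonneg (le_of_lt hy.1) _) y
  set g : ℝ → ℝ := fun y => r⁻¹ * (f y + f (-y)) + r ^ (-b) * cauchyKernel c (x - y) with hg
  have hki : Integrable fun y => cauchyKernel c (x - y) :=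
    (integrable_cauchyKernel hc).comp_sub_left x
  have hgi : Integrable g := ((hfi.add hfi.comp_neg).const_mul _).add (hki.const_mul _)
  have hgv : ∫ y, g y = (2 / (1 - b) + Real.pi) * r ^ (-b) := by
    have hff : Integrable fun y => f y + f (-y) := hfi.add hfi.comp_neg
    simp only [hg]
    rw [integral_add (hff.const_mul _) (hki.const_mul _),
      integral_const_mul, integral_const_mul, integral_add hfi hfi.comp_neg,
      integral_neg_eq_self f, integral_sub_left_eq_self (cauchyKernel c), integral_cauchyKernel hc,
      hfv, sub_eq_add_neg 1 b, Real.rpow_add hr, Real.rpow_one]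
    field_simp
    ring
  have hle : ∀ᵐ y, ‖cauchyKernel c (x - y) * |y| ^ (-b)‖ ≤ g y := by
    have : ∀ᵐ y : ℝ, y ≠ 0 := by simp [ae_iff]
    filter_upwards [this] with y hy
    have hk0 := cauchyKernel_nonneg hc (x - y)
    have hp : 0 < |y| := abs_pos.2 hy
    rw [Real.norm_of_nonneg (mul_nonneg hk0 (Real.rpow_nonneg hp.le _))]
    have hrb := Real.rpow_nonneg hr.le (-b)
    rcases lt_or_ge |y| r with h | h
    · have h1 : |y| ^ (-b) ≤ f y + f (-y) := by
        rcases abs_cases y with ⟨e, h0⟩ | ⟨e, h0⟩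
        · have : f y = |y| ^ (-b) := by
            rw [hf, indicator_of_mem (by rw [← e]; exact ⟨hp, h.le⟩), e]
          linarith [hf0 (-y)]
        · have : f (-y) = |y| ^ (-b) := by
            rw [hf, indicator_of_mem (by rw [← e]; exact ⟨hp, h.le⟩), e]
          linarith [hf0 y]
      calc _ ≤ r⁻¹ * (f y + f (-y)) := by
            gcongr
            exact hk y h
        _ ≤ g y := by simp only [hg]; linarith [mul_nonneg hrb hk0]
    · have h1 : |y| ^ (-b) ≤ r ^ (-b) :=
        Real.rpow_le_rpow_of_nonpos hr h (by linarith)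
      calc _ ≤ r ^ (-b) * cauchyKernel c (x - y) := by rw [mul_comm]; gcongr
        _ ≤ g y := by
          have := mul_nonneg (inv_nonneg.2 hr.le) (add_nonneg (hf0 y) (hf0 (-y)))
          simp only [hg]; linarith
  have hm : AEStronglyMeasurable (fun y => cauchyKernel c (x - y) * |y| ^ (-b)) := by
    have := measurable_cauchyKernel c
    refine Measurable.aestronglyMeasurable ?_
    fun_prop
  refine ⟨hgi.mono' hm hle, ?_⟩
  rw [← hgv]
  exact integral_mono_ae (hgi.mono' hm hle) hgi
    (hle.mono fun y hy => (le_abs_self _).trans hy)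

/-! ### The anisotropic product kernel and the temporal weight -/

section Kernel

variable {d : ℕ} (S : Setting d)

/-- The product of Cauchy kernels at the scale `t^{s/ℓ}`. -/
noncomputable def Setting.kern (t : ℝ) (z : Pt d) : ℝ :=
  ∏ i, cauchyKernel (t ^ (-(S.s i / S.ℓ))) (z i)

variable {S}

lemma Setting.s_pos (S : Setting d) (i : Fin d) : 0 < S.s i :=
  zero_lt_one.trans_le (S.one_le_s i)

lemma Setting.kern_nonneg {t : ℝ} (ht : 0 < t) (z : Pt d) : 0 ≤ S.kern t z :=
  Finset.prod_nonneg fun _ _ => cauchyKernel_nonneg (Real.rpow_pos_of_pos ht _) _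

lemma Setting.integrable_kern {t : ℝ} (ht : 0 < t) (x : Pt d) :
    Integrable fun y => S.kern t (x - y) :=
  Integrable.comp_sub_left (f := fun z => S.kern t z) (Integrable.fintype_prod
    (f := fun i => cauchyKernel (t ^ (-(S.s i / S.ℓ))))
    fun _ => integrable_cauchyKernel (Real.rpow_pos_of_pos ht _)) x

lemma Setting.integral_kern {t : ℝ} (ht : 0 < t) (x : Pt d) :
    ∫ y, S.kern t (x - y) = Real.pi ^ d := by
  rw [integral_sub_left_eq_self (fun z : Pt d => S.kern t z)]
  unfold Setting.kern
  rw [integral_fintype_prod_volume_eq_prod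
    (f := fun i => cauchyKernel (t ^ (-(S.s i / S.ℓ)))), Finset.prod_congr rfl fun i _ =>
    integral_cauchyKernel (Real.rpow_pos_of_pos ht _)]
  simp

lemma Setting.anorm_nonneg (x : Pt d) : 0 ≤ S.anorm x :=
  Finset.sum_nonneg fun _ _ => Real.rpow_nonneg (abs_nonneg _) _

lemma Setting.continuous_anorm : Continuous S.anorm := by
  unfold Setting.anorm
  refine continuous_finsetSum _ fun i _ => ?_
  exact (continuous_apply i).abs.rpow_const fun _ => Or.inr (one_div_pos.2 (S.s_pos i)).le

lemma Setting.anorm_zero : S.anorm 0 = 0 :=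
  Finset.sum_eq_zero fun i _ => by
    simp [Real.zero_rpow (inv_pos.2 (S.s_pos i)).ne']

lemma Setting.anorm_neg (x : Pt d) : S.anorm (-x) = S.anorm x := by simp [Setting.anorm]

lemma Setting.anorm_dil {t : ℝ} (ht : 0 < t) (x : Pt d) :
    S.anorm (S.dil t x) = t ^ (1 / S.ℓ) * S.anorm x := by
  unfold Setting.anorm Setting.dil
  rw [Finset.mul_sum]
  refine Finset.sum_congr rfl fun i _ => ?_
  have := (S.s_pos i).ne'
  rw [abs_mul, abs_of_pos (Real.rpow_pos_of_pos ht _),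
    Real.mul_rpow (Real.rpow_nonneg ht.le _) (abs_nonneg _), ← Real.rpow_mul ht.le]
  congr 2
  field_simp

lemma Setting.dil_dilInv {t : ℝ} (ht : 0 < t) (x : Pt d) : S.dil t (S.dilInv t x) = x := by
  funext i
  simp only [Setting.dil, Setting.dilInv]
  rw [← mul_assoc, ← Real.rpow_add ht, add_neg_cancel, Real.rpow_zero, one_mul]

/-- Since `s_i ≥ 1`, taking the power `1 / s_i` does not decrease numbers in `(0,1]`. This converts
distance in the sup norm into a moment of `‖·‖_s`. -/
lemma Setting.le_anorm_of_le_norm {δ : ℝ} (h0 : 0 < δ) (h1 : δ ≤ 1) {z : Pt d} (hz : δ ≤ ‖z‖) :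
    δ ≤ S.anorm z := by
  obtain ⟨i, hi⟩ : ∃ i, δ ≤ |z i| := by
    by_contra! h
    exact absurd hz (not_le.2 ((pi_norm_lt_iff h0).2 h))
  have h2 : |z i| ^ (1 / S.s i) ≤ S.anorm z :=
    Finset.single_le_sum (f := fun i => |z i| ^ (1 / S.s i))
      (fun j _ => Real.rpow_nonneg (abs_nonneg _) _) (Finset.mem_univ i)
  have h3 : δ ^ (1 / S.s i) ≤ |z i| ^ (1 / S.s i) :=
    Real.rpow_le_rpow h0.le hi (one_div_pos.2 (S.s_pos i)).le
  have h4 : δ ^ (1 : ℝ) ≤ δ ^ (1 / S.s i) :=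
    Real.rpow_le_rpow_of_exponent_ge h0 h1 ((div_le_one (S.s_pos i)).2 (S.one_le_s i))
  rw [Real.rpow_one] at h4
  linarith

/-- Weighted moments of `G_t` are controlled by the product kernel. -/
lemma GWeight.exists_Gt_bound (u : GWeight S) {p : ℝ} (hp : 0 ≤ p) :
    ∃ B : ℝ, 0 ≤ B ∧ ∀ t ∈ Ioc (0 : ℝ) 1, ∀ z : Pt d,
      S.Gt t z * u.star z * S.anorm z ^ p ≤ B * t ^ (p / S.ℓ) * S.kern t z := by
  obtain ⟨n, hn⟩ := exists_nat_ge p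
  -- The moment is hidden in a new `G`, namely `(1 + ‖x‖_s^n) G(x)`. The weight stays controlled
  -- because its defining bounds hold for every power of `‖x‖_s`, so `exists_prod_bound` applies to
  -- the modified setting.
  let S' : Setting d :=
    { S with
      G := fun x => (1 + S.anorm x ^ n) * S.G x
      G_nonneg := fun x => mul_nonneg
        (add_nonneg zero_le_one (pow_nonneg (S.anorm_nonneg x) n)) (S.G_nonneg x)
      G_meas := ((continuous_const.add (S.continuous_anorm.pow n)).measurable).mul S.G_meas }
  let u' : GWeight S' :=
    { u with
      integrable := fun m T hT => by
        obtain ⟨C, hC⟩ := u.integrable m T hT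
        obtain ⟨D, hD⟩ := u.integrable (m + n) T hT
        refine ⟨C + D, fun t ht x => ?_⟩
        refine le_trans (le_of_eq ?_) (add_le_add (hC t ht x) (hD t ht x))
        change S.anorm x ^ m * u.star (S.dil t x) * ((1 + S.anorm x ^ n) * S.G x) = _
        ring }
  obtain ⟨B, hB0, hB⟩ := u'.exists_prod_bound
  refine ⟨B, hB0, fun t ht z => ?_⟩
  have ht0 := ht.1
  have hb := hB t ht (S.dilInv t z)
  change u.star (S.dil t (S.dilInv t z)) * ((1 + S.anorm (S.dilInv t z) ^ n) *
    S.G (S.dilInv t z)) ≤ _ at hb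
  rw [S.dil_dilInv ht0] at hb
  set x := S.dilInv t z with hx
  -- Homogeneity of `‖·‖_s` under the dilation produces the factor `t^{p/ℓ}`.
  have hz : S.anorm z = t ^ (1 / S.ℓ) * S.anorm x := by
    rw [← S.anorm_dil ht0, hx, S.dil_dilInv ht0]
  have hr0 := S.anorm_nonneg x
  have hpow : S.anorm x ^ p ≤ 1 + S.anorm x ^ n := by
    rcases le_total (S.anorm x) 1 with h | h
    · linarith [Real.rpow_le_one hr0 h hp, pow_nonneg hr0 n]
    · have := Real.rpow_le_rpow_of_exponent_le h hn
      rw [Real.rpow_natCast] at this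
      linarith
  have hpre : t ^ (-((∑ i, S.s i) / S.ℓ)) = ∏ i, t ^ (-(S.s i / S.ℓ)) := by
    rw [← Real.rpow_sum_of_pos ht0, Finset.sum_neg_distrib, Finset.sum_div]
  have hP : 0 ≤ ∏ i, t ^ (-(S.s i / S.ℓ)) :=
    Finset.prod_nonneg fun i _ => Real.rpow_nonneg ht0.le _
  have htp : 0 ≤ t ^ (p / S.ℓ) := Real.rpow_nonneg ht0.le _
  have hs0 : 0 ≤ u.star z := zero_le_one.trans (u.one_le_star _)
  have hG := S.G_nonneg x
  rw [hz, Real.mul_rpow (Real.rpow_nonneg ht0.le _) hr0, ← Real.rpow_mul ht0.le,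
    one_div_mul_eq_div, Setting.Gt, hpre, ← hx]
  calc _ = (∏ i, t ^ (-(S.s i / S.ℓ))) * t ^ (p / S.ℓ) *
        (u.star z * (S.anorm x ^ p * S.G x)) := by ring
    _ ≤ (∏ i, t ^ (-(S.s i / S.ℓ))) * t ^ (p / S.ℓ) * (B * ∏ i, (1 + x i ^ 2)⁻¹) := by
        refine mul_le_mul_of_nonneg_left (le_trans ?_ hb) (mul_nonneg hP htp)
        gcongr
    _ = _ := by
        simp only [Setting.kern, cauchyKernel, Finset.prod_mul_distrib, hx, Setting.dilInv]
        ring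

variable [NeZero d]

lemma Setting.phi_nonneg (x : Pt d) : 0 ≤ S.phi x :=
  le_min (Real.rpow_nonneg (abs_nonneg _) _) zero_le_one

lemma Setting.phi_pos {x : Pt d} (hx : x 0 ≠ 0) : 0 < S.phi x :=
  lt_min (Real.rpow_pos_of_pos (abs_pos.2 hx) _) one_pos

lemma Setting.phi_le_one (x : Pt d) : S.phi x ≤ 1 := min_le_right _ _

lemma Setting.continuous_phi : Continuous S.phi :=
  ((continuous_apply 0).abs.rpow_const fun _ =>
    Or.inr (one_div_pos.2 (S.s_pos 0)).le).min continuous_const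

lemma Setting.one_le_phi_rpow {a : ℝ} (ha : 0 ≤ a) {x : Pt d} (hx : x 0 ≠ 0) :
    1 ≤ S.phi x ^ (-a) :=
  Real.one_le_rpow_of_pos_of_le_one_of_nonpos (S.phi_pos hx) (S.phi_le_one x) (by linarith)

lemma Setting.abs_rpow_le_phi_rpow {a : ℝ} (ha : 0 ≤ a) {x : Pt d} (hx : x 0 ≠ 0) :
    |x 0| ^ (-(a / S.s 0)) ≤ S.phi x ^ (-a) := by
  have h := Real.rpow_le_rpow_of_nonpos (S.phi_pos hx) (min_le_left _ _ : S.phi x ≤ _)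
    (by linarith : -a ≤ 0)
  rw [← Real.rpow_mul (abs_nonneg _)] at h
  convert h using 2
  ring

lemma Setting.phi_rpow_le {a : ℝ} (x : Pt d) :
    S.phi x ^ (-a) ≤ |x 0| ^ (-(a / S.s 0)) + 1 := by
  have h0 := Real.rpow_nonneg (abs_nonneg (x 0)) (-(a / S.s 0))
  rcases min_choice (|x 0| ^ (1 / S.s 0)) 1 with h | h
  · rw [Setting.phi, h, ← Real.rpow_mul (abs_nonneg _)]
    have : 1 / S.s 0 * -a = -(a / S.s 0) := by ring
    rw [this]; linarith
  · rw [Setting.phi, h, Real.one_rpow]; linarith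

/-- The hyperplane is a proper subspace, hence null. Bounds are therefore needed only off it; on it
`f` is arbitrary. -/
lemma ae_ne_zero : ∀ᵐ x : Pt d, x 0 ≠ 0 := by
  have h := Measure.addHaar_submodule (volume : Measure (Pt d))
    (LinearMap.ker (LinearMap.proj 0 : Pt d →ₗ[ℝ] ℝ)) (fun h => by
      have h1 : (Pi.single 0 1 : Pt d) ∈ LinearMap.ker (LinearMap.proj 0 : Pt d →ₗ[ℝ] ℝ) := by
        rw [h]; trivial
      simp at h1)
  rw [ae_iff]
  convert h using 2
  ext x
  simp

/-- Convolution of the product kernel with a negative power of `φ`. -/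
lemma Setting.kern_conv_phi (S : Setting d) {a : ℝ} (ha : 0 ≤ a) (ha1 : a < S.s 0) :
    ∃ K : ℝ, 0 ≤ K ∧ ∀ t ∈ Ioc (0 : ℝ) 1, ∀ x : Pt d,
      Integrable (fun y => S.kern t (x - y) * S.phi y ^ (-a)) ∧
      ∫ y, S.kern t (x - y) * S.phi y ^ (-a) ≤ K * t ^ (-a / S.ℓ) ∧
      (x 0 ≠ 0 → ∫ y, S.kern t (x - y) * S.phi y ^ (-a) ≤ K * S.phi x ^ (-a)) := by
  set b := a / S.s 0 with hb
  have hs := S.s_pos 0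
  have hb0 : 0 ≤ b := div_nonneg ha hs.le
  have hb1 : b < 1 := (div_lt_one hs).2 ha1
  set D : ℝ := 2 / (1 - b) + Real.pi with hD
  have hD0 : 0 ≤ D := add_nonneg (div_nonneg zero_le_two (by linarith)) Real.pi_pos.le
  have hpi := Real.pi_pos.le
  set N : ℝ := Real.pi ^ (Finset.univ.erase (0 : Fin d)).card with hN
  have hN0 : 0 ≤ N := pow_nonneg hpi _
  refine ⟨2 * (D * N) + Real.pi ^ d, by positivity, fun t ht x => ?_⟩
  have ht0 := ht.1
  set c : Fin d → ℝ := fun i => t ^ (-(S.s i / S.ℓ)) with hc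
  have hcpos : ∀ i, 0 < c i := fun i => Real.rpow_pos_of_pos ht0 _
  -- The choice `r = t^{s_1/ℓ}` will give the bound in `t`, and `r = |x_1| / 2` the bound in `φ(x)`.
  have hconv : ∀ r : ℝ, 0 < r → (∀ y, |y| < r → cauchyKernel (c 0) (x 0 - y) ≤ r⁻¹) →
      Integrable (fun y => S.kern t (x - y) * S.phi y ^ (-a)) ∧
      ∫ y, S.kern t (x - y) * S.phi y ^ (-a) ≤ D * N * r ^ (-b) + Real.pi ^ d := by
    intro r hr hk
    obtain ⟨hi, hv⟩ := cauchyKernel_conv_rpow hb0 hb1 (hcpos 0) hr hk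
    -- The singularity sits in coordinate `0` only, so the integrand is still a product; each other
    -- factor integrates to `π`.
    let k : Fin d → ℝ → ℝ := fun i u =>
      cauchyKernel (c i) (x i - u) * (if i = 0 then |u| ^ (-b) else 1)
    have hk0 : ∀ i ≠ 0, k i = fun u => cauchyKernel (c i) (x i - u) := by
      intro i h
      funext u
      simp [k, h]
    have hki : ∀ i, Integrable (k i) := by
      intro i
      by_cases h : i = 0
      · subst h; simpa [k] using hi
      · rw [hk0 i h]
        exact (integrable_cauchyKernel (hcpos i)).comp_sub_left (x i)
    have hprod : ∀ y : Pt d, ∏ i, k i (y i) = S.kern t (x - y) * |y 0| ^ (-b) := by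
      intro y
      simp only [k, Finset.prod_mul_distrib, Finset.prod_ite_eq',
        Finset.mem_univ, if_true, Setting.kern, Pi.sub_apply, hc]
    have hint : Integrable (fun y : Pt d => S.kern t (x - y) * |y 0| ^ (-b)) := by
      simp only [← hprod]
      exact Integrable.fintype_prod (f := k) hki
    have hval : ∫ y : Pt d, S.kern t (x - y) * |y 0| ^ (-b) ≤ D * N * r ^ (-b) := by
      simp only [← hprod]
      rw [integral_fintype_prod_volume_eq_prod, ← Finset.mul_prod_erase _ _ (Finset.mem_univ 0),
        Finset.prod_congr rfl (g := fun _ => Real.pi), Finset.prod_const, ← hN]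
      · have : ∫ u, k 0 u ≤ D * r ^ (-b) := by simpa [k] using hv
        calc _ ≤ D * r ^ (-b) * N := by gcongr
          _ = _ := by ring
      · intro i h
        rw [hk0 i (Finset.ne_of_mem_erase h), integral_sub_left_eq_self (cauchyKernel (c i)),
          integral_cauchyKernel (hcpos i)]
    have hki' := S.integrable_kern ht0 x
    have hle : ∀ y, S.kern t (x - y) * S.phi y ^ (-a) ≤
        S.kern t (x - y) * |y 0| ^ (-b) + S.kern t (x - y) := by
      intro y
      have h1 := mul_le_mul_of_nonneg_left (S.phi_rpow_le (a := a) y)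
        (S.kern_nonneg ht0 (x - y))
      rw [mul_add, mul_one] at h1
      exact h1
    have h0 : ∀ y, 0 ≤ S.kern t (x - y) * S.phi y ^ (-a) := fun y =>
      mul_nonneg (S.kern_nonneg ht0 _) (Real.rpow_nonneg (S.phi_nonneg _) _)
    have hI : Integrable (fun y => S.kern t (x - y) * S.phi y ^ (-a)) := by
      refine (hint.add hki').mono' ?_ (Eventually.of_forall fun y => ?_)
      · exact hki'.aestronglyMeasurable.mul
          ((S.continuous_phi.measurable.pow_const (-a)).aestronglyMeasurable)
      · rw [Real.norm_of_nonneg (h0 y)]; exact hle y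
    refine ⟨hI, (integral_mono hI (hint.add hki') hle).trans ?_⟩
    change ∫ y, (S.kern t (x - y) * |y 0| ^ (-b) + S.kern t (x - y)) ≤ _
    rw [integral_add hint hki', S.integral_kern ht0]
    linarith
  have hDN : 0 ≤ D * N := mul_nonneg hD0 hN0
  have hpd : 0 ≤ Real.pi ^ d := pow_nonneg hpi d
  obtain ⟨h1, h2⟩ := hconv (c 0)⁻¹ (inv_pos.2 (hcpos 0)) fun y _ => by
    rw [inv_inv]; exact cauchyKernel_le (hcpos 0) _
  refine ⟨h1, h2.trans ?_, fun hx => ?_⟩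
  · have e : ((c 0)⁻¹) ^ (-b) = t ^ (-a / S.ℓ) := by
      rw [Real.rpow_neg (inv_nonneg.2 (hcpos 0).le), Real.inv_rpow (hcpos 0).le, inv_inv,
        ← Real.rpow_mul ht0.le]
      congr 1
      rw [hb]
      field_simp
    have h3 : 1 ≤ t ^ (-a / S.ℓ) := Real.one_le_rpow_of_pos_of_le_one_of_nonpos ht0 ht.2
      (div_nonpos_of_nonpos_of_nonneg (by linarith) S.ℓ_pos.le)
    rw [e]
    nlinarith [mul_nonneg hDN (zero_le_one.trans h3), mul_nonneg hpd (sub_nonneg.2 h3)]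
  · have hr : 0 < |x 0| / 2 := half_pos (abs_pos.2 hx)
    obtain ⟨-, h4⟩ := hconv (|x 0| / 2) hr fun y hy => cauchyKernel_le_inv (hcpos 0) hr (by
      have := abs_sub_abs_le_abs_sub (x 0) y
      linarith)
    refine h4.trans ?_
    have h5 : (|x 0| / 2) ^ (-b) ≤ 2 * S.phi x ^ (-a) := by
      rw [Real.div_rpow (abs_nonneg _) zero_le_two, div_eq_mul_inv,
        ← Real.rpow_neg zero_le_two, neg_neg, mul_comm]
      have h6 : (2 : ℝ) ^ b ≤ 2 ^ (1 : ℝ) :=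
        Real.rpow_le_rpow_of_exponent_le one_le_two hb1.le
      rw [Real.rpow_one] at h6
      have h7 := S.abs_rpow_le_phi_rpow ha hx
      have := Real.rpow_nonneg (abs_nonneg (x 0)) (-b)
      gcongr
    have h8 := S.one_le_phi_rpow ha hx
    nlinarith [mul_le_mul_of_nonneg_left h5 hDN, mul_nonneg hpd (sub_nonneg.2 h8)]

end Kernel

/-! ### The operators `Q_t` on continuous and on singular functions -/

section Operator

variable {d : ℕ} {S : Setting d} (Q : GSemigroup S) (u : GWeight S)

/-- For `t ≤ 1` the smallest exponent governs the sum. Several exponents occur at once because a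
modelled distribution has one increment bound per degree. -/
lemma GSemigroup.exists_moment_bound {ι : Type*} (A : Finset ι) (p : ι → ℝ) {q : ℝ} (hq : 0 ≤ q)
    (hp : ∀ i ∈ A, q ≤ p i) :
    ∃ B : ℝ, 0 ≤ B ∧ ∀ t ∈ Ioc (0 : ℝ) 1, ∀ x y : Pt d,
      |Q.Q t x y| * (u.star (x - y) * ∑ i ∈ A, S.anorm (x - y) ^ p i) ≤
        B * t ^ (q / S.ℓ) * S.kern t (x - y) := by
  obtain ⟨C, hC0, hC⟩ := Q.upper
  have h : ∀ i, ∃ B : ℝ, 0 ≤ B ∧ (i ∈ A → ∀ t ∈ Ioc (0 : ℝ) 1, ∀ z : Pt d,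
      S.Gt t z * u.star z * S.anorm z ^ p i ≤ B * t ^ (q / S.ℓ) * S.kern t z) := by
    intro i
    by_cases hi : i ∈ A
    · obtain ⟨B, hB0, hB⟩ := u.exists_Gt_bound (hq.trans (hp i hi))
      refine ⟨B, hB0, fun _ t ht z => (hB t ht z).trans ?_⟩
      have hk := S.kern_nonneg ht.1 z
      have ht' : t ^ (p i / S.ℓ) ≤ t ^ (q / S.ℓ) :=
        Real.rpow_le_rpow_of_exponent_ge ht.1 ht.2
          (div_le_div_of_nonneg_right (hp i hi) S.ℓ_pos.le)
      gcongr
    · exact ⟨0, le_rfl, fun h => absurd h hi⟩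
  choose B hB0 hB using h
  refine ⟨C * ∑ i ∈ A, B i, mul_nonneg hC0.le (Finset.sum_nonneg fun i _ => hB0 i),
    fun t ht x y => ?_⟩
  have hs : 0 ≤ u.star (x - y) := zero_le_one.trans (u.one_le_star _)
  have hsum : 0 ≤ ∑ i ∈ A, S.anorm (x - y) ^ p i :=
    Finset.sum_nonneg fun i _ => Real.rpow_nonneg (S.anorm_nonneg _) _
  calc _ ≤ C * S.Gt t (x - y) * (u.star (x - y) * ∑ i ∈ A, S.anorm (x - y) ^ p i) :=
        mul_le_mul_of_nonneg_right (hC t ht.1 x y) (mul_nonneg hs hsum)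
    _ = C * ∑ i ∈ A, S.Gt t (x - y) * u.star (x - y) * S.anorm (x - y) ^ p i := by
        rw [← Finset.mul_sum]; ring
    _ ≤ C * ∑ i ∈ A, B i * t ^ (q / S.ℓ) * S.kern t (x - y) := by
        exact mul_le_mul_of_nonneg_left (Finset.sum_le_sum fun i hi => hB i hi t ht _) hC0.le
    _ = _ := by rw [← Finset.sum_mul, ← Finset.sum_mul]; ring

lemma GWeight.val_le (x y : Pt d) : u.val x ≤ u.star (x - y) * u.val y := by
  have := u.moderate (x - y) y
  rwa [sub_add_cancel] at this

/-- Moderateness moves the weight from `x` to `y` at the price of `u^*(x-y)`, which the product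
kernel absorbs. -/
lemma GSemigroup.exists_weighted_bound :
    ∃ B : ℝ, 0 ≤ B ∧ ∀ t ∈ Ioc (0 : ℝ) 1, ∀ x y : Pt d,
      u.val x * |Q.Q t x y| ≤ B * S.kern t (x - y) * u.val y := by
  obtain ⟨B, hB0, hB⟩ := Q.exists_moment_bound u {()} (fun _ => 0) le_rfl (fun _ _ => le_rfl)
  refine ⟨B, hB0, fun t ht x y => ?_⟩
  have h := hB t ht x y
  simp only [Finset.sum_singleton, Real.rpow_zero, mul_one, zero_div] at h
  calc _ ≤ u.star (x - y) * u.val y * |Q.Q t x y| := by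
        gcongr
        exact u.val_le x y
    _ = |Q.Q t x y| * u.star (x - y) * u.val y := by ring
    _ ≤ _ := mul_le_mul_of_nonneg_right h (u.val_pos y).le

lemma GSemigroup.continuous_Q_right {t : ℝ} (ht : 0 < t) (x : Pt d) :
    Continuous (Q.Q t x) :=
  (Q.continuous_Q t ht).comp (continuous_const.prodMk continuous_id)

lemma CW.exists_bound {u : GWeight S} (g : CW u) :
    ∃ M : ℝ, 0 ≤ M ∧ ∀ y, u.val y * |(g : Pt d → ℝ) y| ≤ M := by
  obtain ⟨_, M, hM⟩ := g.2
  exact ⟨M, (mul_nonneg (u.val_pos 0).le (abs_nonneg _)).trans (hM 0), hM⟩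

lemma GSemigroup.act_sub {t : ℝ} {x : Pt d} {g h : Pt d → ℝ}
    (hg : Integrable fun y => Q.Q t x y * g y) (hh : Integrable fun y => Q.Q t x y * h y) :
    Q.act t x (fun y => g y - h y) = Q.act t x g - Q.act t x h := by
  simp only [GSemigroup.act, mul_sub]
  exact integral_sub hg hh

/-- `Q_t(x,g) → g(x)` as `t ↓ 0`, for `g ∈ C(u)`. -/
lemma GSemigroup.tendsto_act {u : GWeight S} (g : CW u) (x : Pt d) :
    Tendsto (fun t => Q.act t x g) (𝓝[>] 0) (𝓝 ((g : Pt d → ℝ) x)) := by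
  obtain ⟨M, hM0, hM⟩ := CW.exists_bound g
  obtain ⟨B, hB0, hB⟩ := Q.exists_moment_bound u {()} (fun _ => 0) le_rfl (fun _ _ => le_rfl)
  obtain ⟨B', hB0', hB'⟩ := Q.exists_moment_bound u {()} (fun _ => 1) zero_le_one
    (fun _ _ => le_rfl)
  simp only [Finset.sum_singleton, Real.rpow_zero, mul_one, zero_div, Real.rpow_one] at hB hB'
  set N := M + |(g : Pt d → ℝ) x| with hN
  have hN0 : 0 ≤ N := add_nonneg hM0 (abs_nonneg _)
  have hux := u.val_pos x
  have hdiff : ∀ y, u.val x * |(g : Pt d → ℝ) y - (g : Pt d → ℝ) x| ≤ N * u.star (x - y) := by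
    intro y
    have h1 := u.val_le x y
    have h2 := u.one_le_star (x - y)
    have h3 := hM y
    have h4 := u.val_le_one x
    have h5 : u.val x * |(g : Pt d → ℝ) y| ≤ u.star (x - y) * M := by
      calc _ ≤ u.star (x - y) * u.val y * |(g : Pt d → ℝ) y| := by gcongr
        _ = u.star (x - y) * (u.val y * |(g : Pt d → ℝ) y|) := by ring
        _ ≤ _ := by gcongr
    have h6 : u.val x * |(g : Pt d → ℝ) x| ≤ u.star (x - y) * |(g : Pt d → ℝ) x| := by
      gcongr
      exact h4.trans h2
    calc _ ≤ u.val x * (|(g : Pt d → ℝ) y| + |(g : Pt d → ℝ) x|) := by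
          gcongr
          exact abs_sub _ _
      _ ≤ _ := by rw [hN]; linarith
  have hpd : (0 : ℝ) ≤ Real.pi ^ d := pow_nonneg Real.pi_pos.le d
  have hone : ∀ t ∈ Ioc (0 : ℝ) 1, Integrable (fun y => Q.Q t x y) := by
    intro t ht
    refine ((S.integrable_kern ht.1 x).const_mul B).mono'
      (Q.continuous_Q_right ht.1 x).aestronglyMeasurable (Eventually.of_forall fun y => ?_)
    refine le_trans ?_ (hB t ht x y)
    exact le_mul_of_one_le_right (abs_nonneg _) (u.one_le_star _)
  have hsub : Tendsto (fun t => Q.act t x (fun y => (g : Pt d → ℝ) y - (g : Pt d → ℝ) x))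
      (𝓝[>] 0) (𝓝 0) := by
    rw [Metric.tendsto_nhds]
    intro ε hε
    -- Chosen so that the part near `x` contributes at most `ε / 2`; the `+ 1` keeps the denominator
    -- positive.
    set ε' := ε / (2 * (B * Real.pi ^ d + 1)) with hε'
    have hε0 : 0 < ε' := by positivity
    obtain ⟨δ₀, hδ₀, hcont⟩ := Metric.continuous_iff.1 g.2.1 x ε' hε0
    set δ := min δ₀ 1 with hδ
    have hδ0 : 0 < δ := lt_min hδ₀ one_pos
    -- Near `x` this is continuity of `g`. Away from `x`, a factor `δ⁻¹ ‖x-y‖_s ≥ 1` is inserted,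
    -- and the first moment of the kernel then supplies `t^{1/ℓ} → 0`.
    have hpt : ∀ y, |(g : Pt d → ℝ) y - (g : Pt d → ℝ) x| ≤
        ε' * u.star (x - y) + (u.val x)⁻¹ * N * δ⁻¹ * (u.star (x - y) * S.anorm (x - y)) := by
      intro y
      have hs := u.one_le_star (x - y)
      have ha := S.anorm_nonneg (x - y)
      rcases lt_or_ge ‖x - y‖ δ with h | h
      · have h1 := hcont y (by
          rw [dist_comm, dist_eq_norm]; exact h.trans_le (min_le_left _ _))
        rw [Real.dist_eq] at h1
        have h2 : 0 ≤ (u.val x)⁻¹ * N * δ⁻¹ * (u.star (x - y) * S.anorm (x - y)) := by positivity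
        have h3 : ε' * 1 ≤ ε' * u.star (x - y) := by gcongr
        linarith
      · have h1 := S.le_anorm_of_le_norm hδ0 (min_le_right _ _) h
        have h2 : 1 ≤ δ⁻¹ * S.anorm (x - y) := by
          rw [← div_eq_inv_mul, one_le_div hδ0]; exact h1
        have h3 := hdiff y
        rw [mul_comm, ← le_div_iff₀ hux] at h3
        have h4 : N * u.star (x - y) / u.val x ≤
            (u.val x)⁻¹ * N * δ⁻¹ * (u.star (x - y) * S.anorm (x - y)) := by
          calc _ = (u.val x)⁻¹ * N * u.star (x - y) * 1 := by ring
            _ ≤ (u.val x)⁻¹ * N * u.star (x - y) * (δ⁻¹ * S.anorm (x - y)) := by gcongr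
            _ = _ := by ring
        have : 0 ≤ ε' * u.star (x - y) := by positivity
        linarith
    set D := (u.val x)⁻¹ * N * δ⁻¹ * B' * Real.pi ^ d with hD
    have hlim : Tendsto (fun t : ℝ => D * t ^ (1 / S.ℓ)) (𝓝[>] 0) (𝓝 0) := by
      have hc := ((Real.continuousAt_rpow_const 0 (1 / S.ℓ)
        (Or.inr (one_div_nonneg.2 S.ℓ_pos.le))).tendsto.const_mul D).mono_left
        (nhdsWithin_le_nhds (s := Ioi 0))
      rwa [Real.zero_rpow (one_div_pos.2 S.ℓ_pos).ne', mul_zero] at hc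
    have hev : ∀ᶠ t in 𝓝[>] (0 : ℝ), D * t ^ (1 / S.ℓ) < ε / 2 :=
      hlim.eventually_lt_const (half_pos hε)
    filter_upwards [hev, Ioc_mem_nhdsGT (zero_lt_one (α := ℝ))] with t h1 ht
    rw [dist_zero_right]
    have hk := S.integrable_kern ht.1 x
    refine lt_of_le_of_lt (norm_integral_le_of_norm_le (hk.const_mul
      (ε' * B + (u.val x)⁻¹ * N * δ⁻¹ * B' * t ^ (1 / S.ℓ)))
      (Eventually.of_forall fun y => ?_)) ?_
    · rw [Real.norm_eq_abs, abs_mul]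
      calc _ ≤ |Q.Q t x y| * (ε' * u.star (x - y) +
            (u.val x)⁻¹ * N * δ⁻¹ * (u.star (x - y) * S.anorm (x - y))) := by
            gcongr
            exact hpt y
        _ = ε' * (|Q.Q t x y| * u.star (x - y)) + (u.val x)⁻¹ * N * δ⁻¹ *
            (|Q.Q t x y| * (u.star (x - y) * S.anorm (x - y))) := by ring
        _ ≤ ε' * (B * S.kern t (x - y)) + (u.val x)⁻¹ * N * δ⁻¹ *
            (B' * t ^ (1 / S.ℓ) * S.kern t (x - y)) := by
            exact add_le_add (mul_le_mul_of_nonneg_left (hB t ht x y) hε0.le)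
              (mul_le_mul_of_nonneg_left (hB' t ht x y) (by positivity))
        _ = _ := by ring
    · rw [integral_const_mul, S.integral_kern ht.1]
      have h2 : ε' * B * Real.pi ^ d ≤ ε / 2 := by
        have h3 : B * Real.pi ^ d ≤ B * Real.pi ^ d + 1 := by linarith
        calc _ = ε' * (B * Real.pi ^ d) := by ring
          _ ≤ ε' * (B * Real.pi ^ d + 1) := by gcongr
          _ = ε / 2 := by rw [hε']; field_simp
      have h4 : (ε' * B + (u.val x)⁻¹ * N * δ⁻¹ * B' * t ^ (1 / S.ℓ)) * Real.pi ^ d =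
          ε' * B * Real.pi ^ d + D * t ^ (1 / S.ℓ) := by rw [hD]; ring
      rw [h4]
      linarith
  have hmass := (Q.conservative x).mul_const ((g : Pt d → ℝ) x)
  have h := hsub.add hmass
  rw [zero_add, one_mul] at h
  refine h.congr' ?_
  filter_upwards [Ioc_mem_nhdsGT (zero_lt_one (α := ℝ))] with t ht
  rw [Q.act_sub (Q.integrable_act u ht x g) ((hone t ht).mul_const _)]
  simp only [GSemigroup.act, integral_mul_const]
  ring

lemma GSemigroup.abs_act_le (t : ℝ) (x : Pt d) (h : Pt d → ℝ) :
    u.val x * |Q.act t x h| ≤ u.val x * ∫ y, |Q.Q t x y * h y| :=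
  mul_le_mul_of_nonneg_left abs_integral_le_integral_abs (u.val_pos x).le

variable [NeZero d]

/-- `Q_t` acts on functions with a singularity `φ^{-a}`, `0 ≤ a < s_1`. -/
lemma GSemigroup.exists_singular_bound {a : ℝ} (ha : 0 ≤ a) (ha1 : a < S.s 0) :
    ∃ K : ℝ, 0 ≤ K ∧ ∀ t ∈ Ioc (0 : ℝ) 1, ∀ (x : Pt d) (h : Pt d → ℝ) (M : ℝ), 0 ≤ M →
      (∀ y, y 0 ≠ 0 → u.val y * |h y| ≤ M * S.phi y ^ (-a)) →
      (AEStronglyMeasurable h → Integrable fun y => Q.Q t x y * h y) ∧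
      u.val x * ∫ y, |Q.Q t x y * h y| ≤ K * M * t ^ (-a / S.ℓ) := by
  obtain ⟨B, hB0, hB⟩ := Q.exists_weighted_bound u
  obtain ⟨K, hK0, hK⟩ := S.kern_conv_phi ha ha1
  refine ⟨B * K, mul_nonneg hB0 hK0, fun t ht x h M hM hh => ?_⟩
  have hux := u.val_pos x
  obtain ⟨hi, hv, -⟩ := hK t ht x
  have hle : ∀ᵐ y, |Q.Q t x y * h y| ≤
      (u.val x)⁻¹ * B * M * (S.kern t (x - y) * S.phi y ^ (-a)) := by
    filter_upwards [ae_ne_zero] with y hy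
    have hk := S.kern_nonneg ht.1 (x - y)
    have huy := u.val_pos y
    have h1 : u.val x * |Q.Q t x y * h y| ≤
        B * M * (S.kern t (x - y) * S.phi y ^ (-a)) := by
      calc _ = u.val x * |Q.Q t x y| * |h y| := by rw [abs_mul]; ring
        _ ≤ B * S.kern t (x - y) * u.val y * |h y| := by
          exact mul_le_mul_of_nonneg_right (hB t ht x y) (abs_nonneg _)
        _ = B * S.kern t (x - y) * (u.val y * |h y|) := by ring
        _ ≤ B * S.kern t (x - y) * (M * S.phi y ^ (-a)) := by
          exact mul_le_mul_of_nonneg_left (hh y hy) (mul_nonneg hB0 hk)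
        _ = _ := by ring
    rw [mul_assoc (u.val x)⁻¹, mul_assoc (u.val x)⁻¹, ← div_eq_inv_mul, le_div_iff₀ hux, mul_comm]
    exact h1
  -- Measurability of `h` matters only for integrability. The integral bound holds without it, so it
  -- can later be applied to `z ↦ Q_s(z, D)` with no measurability check.
  refine ⟨fun hm => (hi.const_mul _).mono'
    ((Q.continuous_Q_right ht.1 x).aestronglyMeasurable.mul hm) hle, ?_⟩
  calc _ ≤ u.val x * ∫ y, (u.val x)⁻¹ * B * M * (S.kern t (x - y) * S.phi y ^ (-a)) := by
        refine mul_le_mul_of_nonneg_left ?_ hux.le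
        exact integral_mono_of_nonneg (Eventually.of_forall fun y => abs_nonneg _)
          (hi.const_mul _) hle
    _ = B * M * ∫ y, S.kern t (x - y) * S.phi y ^ (-a) := by
        rw [integral_const_mul]; field_simp
    _ ≤ B * M * (K * t ^ (-a / S.ℓ)) := by gcongr
    _ = _ := by ring

/-- The semigroup property on functions with an integrable singularity. -/
lemma GSemigroup.act_act {a : ℝ} (ha : 0 ≤ a) (ha1 : a < S.s 0) {h : Pt d → ℝ} {M : ℝ}
    (hM : 0 ≤ M) (hm : AEStronglyMeasurable h)
    (hh : ∀ y, y 0 ≠ 0 → u.val y * |h y| ≤ M * S.phi y ^ (-a))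
    {s t : ℝ} (hs : 0 < s) (hst : s < t) (ht : t ≤ 1) (x : Pt d) :
    Q.act t x h = Q.act (t - s) x (fun z => Q.act s z h) := by
  obtain ⟨K, hK0, hK⟩ := Q.exists_singular_bound u ha ha1
  obtain ⟨K', hK0', hK'⟩ := Q.exists_singular_bound u le_rfl (S.s_pos 0)
  have hs1 : s ∈ Ioc (0 : ℝ) 1 := ⟨hs, hst.le.trans ht⟩
  have hts : t - s ∈ Ioc (0 : ℝ) 1 := ⟨sub_pos.2 hst, by linarith⟩
  set L := K * M * s ^ (-a / S.ℓ) with hL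
  have hL0 : 0 ≤ L := mul_nonneg (mul_nonneg hK0 hM) (Real.rpow_nonneg hs.le _)
  have hprod : Integrable
      (Function.uncurry fun z y : Pt d => Q.Q (t - s) x z * (Q.Q s z y * h y))
      (volume.prod volume) := by
    have hmeas : AEStronglyMeasurable
        (Function.uncurry fun z y : Pt d => Q.Q (t - s) x z * (Q.Q s z y * h y))
        (volume.prod volume) := by
      refine (((Q.continuous_Q_right hts.1 x).comp continuous_fst).aestronglyMeasurable).mul ?_
      exact (Q.continuous_Q s hs).aestronglyMeasurable.mul (hm.comp_snd)
    refine (integrable_prod_iff hmeas).2 ⟨Eventually.of_forall fun z => ?_, ?_⟩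
    · exact ((hK s hs1 z h M hM hh).1 hm).const_mul (Q.Q (t - s) x z)
    -- The inner absolute integral is at most `L / u(z)` by the singular bound at time `s`, and `1 /
    -- u` is itself admissible with exponent `0`; this justifies Fubini.
    · have hu : Integrable fun z => Q.Q (t - s) x z * (L * (u.val z)⁻¹) := by
        refine (hK' _ hts x _ L hL0 fun y hy => ?_).1 ?_
        · have := u.val_pos y
          rw [abs_of_nonneg (by positivity), neg_zero, Real.rpow_zero]
          field_simp
          exact le_rfl
        · exact (continuous_const.mul (u.continuous_val.inv₀
            fun z => (u.val_pos z).ne')).aestronglyMeasurable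
      refine hu.norm.mono' hmeas.norm.integral_prod_right' (Eventually.of_forall fun z => ?_)
      have h1 := (hK s hs1 z h M hM hh).2
      have huz := u.val_pos z
      have h2 : ∫ y, |Q.Q s z y * h y| ≤ L * (u.val z)⁻¹ := by
        rw [← div_eq_mul_inv, le_div_iff₀ huz, mul_comm]; exact h1
      have h3 : ∀ y, ‖Function.uncurry (fun z y => Q.Q (t - s) x z * (Q.Q s z y * h y)) (z, y)‖ =
          |Q.Q (t - s) x z| * |Q.Q s z y * h y| := fun y => abs_mul _ _
      simp only [h3]
      rw [integral_const_mul, Real.norm_of_nonneg (mul_nonneg (abs_nonneg _)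
        (integral_nonneg fun y => abs_nonneg _)), norm_mul, Real.norm_eq_abs,
        Real.norm_of_nonneg (by positivity : 0 ≤ L * (u.val z)⁻¹)]
      exact mul_le_mul_of_nonneg_left h2 (abs_nonneg _)
  have hswap := integral_integral_swap hprod
  unfold GSemigroup.act
  calc ∫ y, Q.Q t x y * h y
      = ∫ y, ∫ z, Q.Q (t - s) x z * (Q.Q s z y * h y) := by
        congr 1
        funext y
        rw [← Q.semigroup s t hs hst x y, ← integral_mul_const]
        simp only [mul_assoc]
    _ = ∫ z, ∫ y, Q.Q (t - s) x z * (Q.Q s z y * h y) := hswap.symm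
    _ = _ := by simp only [integral_const_mul]

/-- `Q_t` applied to a function vanishing at order `q` at the base point. -/
lemma GSemigroup.exists_local_bound {ι : Type*} (A : Finset ι) (p : ι → ℝ) {q a : ℝ} (hq : 0 ≤ q)
    (hp : ∀ i ∈ A, q ≤ p i) (ha : 0 ≤ a) (ha1 : a < S.s 0) :
    ∃ K : ℝ, 0 ≤ K ∧ ∀ t ∈ Ioc (0 : ℝ) 1, ∀ x : Pt d, x 0 ≠ 0 → ∀ (h : Pt d → ℝ) (M : ℝ),
      0 ≤ M →
      (∀ y, y 0 ≠ 0 → u.val x * |h y| ≤ M * (S.phi₂ x y ^ (-a) *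
        (u.star (x - y) * ∑ i ∈ A, S.anorm (x - y) ^ p i))) →
      u.val x * |Q.act t x h| ≤ K * M * t ^ (q / S.ℓ) * S.phi x ^ (-a) := by
  obtain ⟨B, hB0, hB⟩ := Q.exists_moment_bound u A p hq hp
  obtain ⟨K, hK0, hK⟩ := S.kern_conv_phi ha ha1
  have hpd : (0 : ℝ) ≤ Real.pi ^ d := pow_nonneg Real.pi_pos.le d
  refine ⟨B * (Real.pi ^ d + K), by positivity, fun t ht x hx h M hM hh => ?_⟩
  have hux := u.val_pos x
  obtain ⟨hi, -, hv⟩ := hK t ht x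
  have hki := S.integrable_kern ht.1 x
  have htq : 0 ≤ t ^ (q / S.ℓ) := Real.rpow_nonneg ht.1.le _
  have hpx : 0 ≤ S.phi x ^ (-a) := Real.rpow_nonneg (S.phi_nonneg x) _
  refine (Q.abs_act_le u t x h).trans ?_
  rw [← integral_const_mul]
  set g : Pt d → ℝ := fun y => M * B * t ^ (q / S.ℓ) *
    (S.phi x ^ (-a) * S.kern t (x - y) + S.kern t (x - y) * S.phi y ^ (-a)) with hg
  have hgi : Integrable g := ((hki.const_mul _).add hi).const_mul _
  have hle : ∀ᵐ y, u.val x * |Q.Q t x y * h y| ≤ g y := by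
    filter_upwards [ae_ne_zero] with y hy
    have hk := S.kern_nonneg ht.1 (x - y)
    have hpy : 0 ≤ S.phi y ^ (-a) := Real.rpow_nonneg (S.phi_nonneg y) _
    -- The term in `φ(x)` meets only the mass of the kernel; the one in `φ(y)` meets the convolution
    -- bound by `φ(x)^{-a}`.
    have hphi : S.phi₂ x y ^ (-a) ≤ S.phi x ^ (-a) + S.phi y ^ (-a) := by
      unfold Setting.phi₂
      rcases min_choice (S.phi x) (S.phi y) with h | h <;> rw [h] <;> linarith
    have hphi0 : 0 ≤ S.phi₂ x y ^ (-a) :=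
      Real.rpow_nonneg (le_min (S.phi_nonneg x) (S.phi_nonneg y)) _
    calc _ = |Q.Q t x y| * (u.val x * |h y|) := by rw [abs_mul]; ring
      _ ≤ |Q.Q t x y| * (M * (S.phi₂ x y ^ (-a) *
          (u.star (x - y) * ∑ i ∈ A, S.anorm (x - y) ^ p i))) := by
          exact mul_le_mul_of_nonneg_left (hh y hy) (abs_nonneg _)
      _ = M * S.phi₂ x y ^ (-a) * (|Q.Q t x y| *
          (u.star (x - y) * ∑ i ∈ A, S.anorm (x - y) ^ p i)) := by ring
      _ ≤ M * S.phi₂ x y ^ (-a) * (B * t ^ (q / S.ℓ) * S.kern t (x - y)) := by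
          exact mul_le_mul_of_nonneg_left (hB t ht x y) (mul_nonneg hM hphi0)
      _ ≤ M * (S.phi x ^ (-a) + S.phi y ^ (-a)) * (B * t ^ (q / S.ℓ) * S.kern t (x - y)) := by
          gcongr
      _ = _ := by simp only [hg]; ring
  refine (integral_mono_of_nonneg (Eventually.of_forall fun y =>
    mul_nonneg hux.le (abs_nonneg _)) hgi hle).trans ?_
  simp only [hg]
  rw [integral_const_mul, integral_add (hki.const_mul _) hi, integral_const_mul,
    S.integral_kern ht.1]
  calc _ ≤ M * B * t ^ (q / S.ℓ) * (S.phi x ^ (-a) * Real.pi ^ d + K * S.phi x ^ (-a)) := by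
        gcongr
        exact hv hx
    _ = _ := by ring

end Operator

/-! ### Elements of the Besov completion given by functions -/

section BesovSpace

variable {d : ℕ} {S : Setting d} {Q : GSemigroup S} {u : GWeight S} {ζ : Iic (0 : ℝ)}

lemma BesovPre.act_sub {t : ℝ} (ht : t ∈ Ioc (0 : ℝ) 1) (x : Pt d) (f g : BesovPre Q u ζ) :
    Q.act t x (f - g).fn = Q.act t x f.fn - Q.act t x g.fn := by
  rw [sub_eq_add_neg, act_add Q u ζ ht, act_neg, ← sub_eq_add_neg]

lemma BesovPre.le_norm {t : ℝ} (ht : t ∈ Ioc (0 : ℝ) 1) (x : Pt d) (f : BesovPre Q u ζ) :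
    t ^ (-(ζ : ℝ) / S.ℓ) * (u.val x * |Q.act t x f.fn|) ≤ ‖f‖ :=
  le_ciSup (besovNorm_bddAbove Q u ζ f) ⟨⟨t, ht⟩, x⟩

lemma BesovPre.norm_le {f : BesovPre Q u ζ} {C : ℝ}
    (h : ∀ t ∈ Ioc (0 : ℝ) 1, ∀ x,
      t ^ (-(ζ : ℝ) / S.ℓ) * (u.val x * |Q.act t x f.fn|) ≤ C) : ‖f‖ ≤ C := by
  have : Nonempty (Ioc (0 : ℝ) 1 × Pt d) := ⟨⟨⟨1, by norm_num⟩, 0⟩⟩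
  exact ciSup_le fun p => h p.1 p.1.2 p.2

lemma Besov.continuous_act (t : ℝ) (x : Pt d) :
    Continuous fun Λ : Besov Q u ζ => Besov.act t x Λ :=
  UniformSpace.Completion.continuous_extension

/-- On `C(u)` this is the definition of the norm; both sides are continuous in `Λ`, so density
suffices. -/
lemma Besov.abs_act_sub_le {t : ℝ} (ht : t ∈ Ioc (0 : ℝ) 1) (x : Pt d) (Λ : Besov Q u ζ)
    (f : BesovPre Q u ζ) :
    t ^ (-(ζ : ℝ) / S.ℓ) * (u.val x * |Besov.act t x Λ - Q.act t x f.fn|) ≤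
      ‖Λ - (f : Besov Q u ζ)‖ := by
  induction Λ using UniformSpace.Completion.induction_on with
  | hp =>
    refine isClosed_le ?_ (continuous_id.sub continuous_const).norm
    exact continuous_const.mul (continuous_const.mul
      ((Besov.continuous_act t x).sub continuous_const).abs)
  | ih g =>
    rw [Besov.act_coe Q u ζ ht, ← UniformSpace.Completion.coe_sub,
      UniformSpace.Completion.norm_coe, ← BesovPre.act_sub ht]
    exact BesovPre.le_norm ht x (g - f)

/-- An element of `C^{ζ,Q}(u)` is determined by the numbers `Q_t(x,Λ)`. -/
lemma Besov.ext_act {Λ₁ Λ₂ : Besov Q u ζ}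
    (h : ∀ t ∈ Ioc (0 : ℝ) 1, ∀ x : Pt d, Besov.act t x Λ₁ = Besov.act t x Λ₂) : Λ₁ = Λ₂ := by
  -- The norm of `f - g` is a supremum of values `Q_t(x, f - g)`, and `Λ₁`, `Λ₂` have equal values
  -- there. So approximants of both are close to each other, up to the two approximation errors.
  have key : ∀ f g : BesovPre Q u ζ,
      dist Λ₁ Λ₂ ≤ 2 * (‖Λ₁ - (f : Besov Q u ζ)‖ + ‖Λ₂ - (g : Besov Q u ζ)‖) := by
    intro f g
    have hfg : ‖f - g‖ ≤ ‖Λ₁ - (f : Besov Q u ζ)‖ + ‖Λ₂ - (g : Besov Q u ζ)‖ := by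
      refine BesovPre.norm_le fun t ht x => ?_
      refine le_trans ?_ (add_le_add (Besov.abs_act_sub_le ht x Λ₁ f)
        (Besov.abs_act_sub_le ht x Λ₂ g))
      rw [BesovPre.act_sub ht, ← mul_add, ← mul_add]
      refine mul_le_mul_of_nonneg_left (mul_le_mul_of_nonneg_left ?_ (u.val_pos x).le)
        (Real.rpow_nonneg ht.1.le _)
      rw [← h t ht x, abs_sub_comm (Besov.act t x Λ₁)]
      exact abs_sub_le _ _ _
    rw [← UniformSpace.Completion.norm_coe, UniformSpace.Completion.coe_sub] at hfg
    have h1 : Λ₁ - Λ₂ = (Λ₁ - (f : Besov Q u ζ)) + ((f : Besov Q u ζ) - g) -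
        (Λ₂ - (g : Besov Q u ζ)) := by abel
    have h2 := norm_sub_le ((Λ₁ - (f : Besov Q u ζ)) + ((f : Besov Q u ζ) - g))
      (Λ₂ - (g : Besov Q u ζ))
    have h3 := norm_add_le (Λ₁ - (f : Besov Q u ζ)) ((f : Besov Q u ζ) - g)
    rw [dist_eq_norm, h1]
    linarith
  -- By density the approximants may be any elements of the completion, in particular `Λ₁` and `Λ₂`
  -- themselves.
  have key' : ∀ Λ Λ' : Besov Q u ζ, dist Λ₁ Λ₂ ≤ 2 * (‖Λ₁ - Λ‖ + ‖Λ₂ - Λ'‖) := by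
    intro Λ Λ'
    induction Λ, Λ' using UniformSpace.Completion.induction_on₂ with
    | hp =>
      refine isClosed_le continuous_const (continuous_const.mul ?_)
      exact (continuous_const.sub continuous_fst).norm.add
        (continuous_const.sub continuous_snd).norm
    | ih f g => exact key f g
  have := key' Λ₁ Λ₂
  simp only [sub_self, norm_zero, add_zero, mul_zero] at this
  exact dist_le_zero.1 this

lemma BesovPre.exists_bound (f : BesovPre Q u ζ) :
    Continuous f.fn ∧ ∃ M : ℝ, 0 ≤ M ∧ ∀ y, u.val y * |f.fn y| ≤ M :=
  ⟨f.2.1, CW.exists_bound (u := u) f⟩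

variable [NeZero d]

/-- If `Q_t(x,Λ)` and `Q_t(x,F)` are asymptotically equal as `t ↓ 0`, then `Λ` is given by `F`. -/
lemma isRealizedBy_of_asymptotic {a b γ : ℝ} (ha : 0 ≤ a) (ha1 : a < S.s 0) (hb : 0 ≤ b)
    (hb1 : b < S.s 0) (hγ : 0 < γ) {F : Pt d → ℝ} (hFm : AEStronglyMeasurable F) {M : ℝ}
    (hM : 0 ≤ M) (hF : ∀ y, y 0 ≠ 0 → u.val y * |F y| ≤ M * S.phi y ^ (-a))
    {Λ : Besov Q u ζ} {C : ℝ} (hC : 0 ≤ C)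
    (hΛ : ∀ t ∈ Ioc (0 : ℝ) 1, ∀ x : Pt d, x 0 ≠ 0 →
      u.val x * |Besov.act t x Λ - Q.act t x F| ≤ C * t ^ (γ / S.ℓ) * S.phi x ^ (-b)) :
    IsRealizedBy Λ F := by
  obtain ⟨Ka, hKa0, hKa⟩ := Q.exists_singular_bound u ha ha1
  obtain ⟨K, hK0, hK⟩ := Q.exists_singular_bound u hb hb1
  have hint : ∀ t ∈ Ioc (0 : ℝ) 1, ∀ x, Integrable fun y => Q.Q t x y * F y :=
    fun t ht x => (hKa t ht x F M hM hF).1 hFm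
  intro t ht x
  refine ⟨hint t ht x, ?_⟩
  have hux := u.val_pos x
  set X := u.val x * |Besov.act t x Λ - Q.act t x F| with hX
  have key : ∀ s, 0 < s → s < t →
      X ≤ K * C * s ^ (γ / S.ℓ) * (t - s) ^ (-b / S.ℓ) := by
    intro s hs hst
    have hs1 : s ∈ Ioc (0 : ℝ) 1 := ⟨hs, hst.le.trans ht.2⟩
    have hts : t - s ∈ Ioc (0 : ℝ) 1 := ⟨sub_pos.2 hst, by linarith [ht.2]⟩
    have hinv : ∀ r : ℝ, 0 < r → ∀ y z : ℝ, r ^ (-(ζ : ℝ) / S.ℓ) * y ≤ z →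
        y ≤ r ^ ((ζ : ℝ) / S.ℓ) * z := by
      intro r hr y z h
      have h' := mul_le_mul_of_nonneg_left h (Real.rpow_nonneg hr.le ((ζ : ℝ) / S.ℓ))
      rwa [← mul_assoc, ← Real.rpow_add hr, neg_div, add_neg_cancel, Real.rpow_zero, one_mul] at h'
    -- The semigroup law is proved for functions, so it is applied to `f - F` with `f ∈ C(u)` in
    -- place of `Λ - F`. The error is a multiple of `‖Λ - f‖` with `s` fixed, and disappears by
    -- density before `s ↓ 0`.
    have hpre : ∀ f : BesovPre Q u ζ, X ≤
        (t ^ ((ζ : ℝ) / S.ℓ) + K * s ^ ((ζ : ℝ) / S.ℓ) * (t - s) ^ (-b / S.ℓ)) *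
          ‖Λ - (f : Besov Q u ζ)‖ + K * C * s ^ (γ / S.ℓ) * (t - s) ^ (-b / S.ℓ) := by
      intro f
      set e := ‖Λ - (f : Besov Q u ζ)‖ with he
      obtain ⟨hfc, Mf, hMf0, hMf⟩ := f.exists_bound
      have h1 := hinv t ht.1 _ _ (Besov.abs_act_sub_le ht x Λ f)
      set D : Pt d → ℝ := fun y => f.fn y - F y with hD
      have hDm : AEStronglyMeasurable D := hfc.aestronglyMeasurable.sub hFm
      have hDb : ∀ y, y 0 ≠ 0 → u.val y * |D y| ≤ (Mf + M) * S.phi y ^ (-a) := by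
        intro y hy
        have h2 := hMf y
        have h3 := hF y hy
        have h4 := S.one_le_phi_rpow ha hy
        calc _ ≤ u.val y * (|f.fn y| + |F y|) :=
              mul_le_mul_of_nonneg_left (abs_sub _ _) (u.val_pos y).le
          _ ≤ Mf * 1 + M * S.phi y ^ (-a) := by rw [mul_add]; linarith
          _ ≤ Mf * S.phi y ^ (-a) + M * S.phi y ^ (-a) := by gcongr
          _ = _ := by ring
      have hDact : ∀ r ∈ Ioc (0 : ℝ) 1, ∀ z,
          Q.act r z D = Q.act r z f.fn - Q.act r z F := fun r hr z =>
        Q.act_sub (Q.integrable_act u hr z f) (hint r hr z)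
      have h5 := Q.act_act u ha ha1 (add_nonneg hMf0 hM) hDm hDb hs hst ht.2 x
      have hsz := Real.rpow_nonneg hs.le ((ζ : ℝ) / S.ℓ)
      have hsg := Real.rpow_nonneg hs.le (γ / S.ℓ)
      have h6 : ∀ z, z 0 ≠ 0 → u.val z * |Q.act s z D| ≤
          (s ^ ((ζ : ℝ) / S.ℓ) * e + C * s ^ (γ / S.ℓ)) * S.phi z ^ (-b) := by
        intro z hz
        have h7 := hinv s hs _ _ (Besov.abs_act_sub_le hs1 z Λ f)
        have h8 := hΛ s hs1 z hz
        have h9 := S.one_le_phi_rpow hb hz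
        rw [hDact s hs1 z]
        calc _ ≤ u.val z * (|Besov.act s z Λ - Q.act s z f.fn| +
              |Besov.act s z Λ - Q.act s z F|) := by
              refine mul_le_mul_of_nonneg_left ?_ (u.val_pos z).le
              rw [abs_sub_comm (Besov.act s z Λ) (Q.act s z f.fn)]
              exact abs_sub_le _ _ _
          _ ≤ s ^ ((ζ : ℝ) / S.ℓ) * e * 1 + C * s ^ (γ / S.ℓ) * S.phi z ^ (-b) := by
              rw [mul_add]; linarith
          _ ≤ s ^ ((ζ : ℝ) / S.ℓ) * e * S.phi z ^ (-b) +
              C * s ^ (γ / S.ℓ) * S.phi z ^ (-b) := by gcongr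
          _ = _ := by ring
      have h10 := (Q.abs_act_le u (t - s) x _).trans (hK (t - s) hts x _ _ (by positivity) h6).2
      rw [← h5, hDact t ht x] at h10
      have h11 : X ≤ u.val x * |Besov.act t x Λ - Q.act t x f.fn| +
          u.val x * |Q.act t x f.fn - Q.act t x F| := by
        rw [← mul_add]
        exact mul_le_mul_of_nonneg_left (abs_sub_le _ _ _) hux.le
      linarith
    have hall : ∀ Λ' : Besov Q u ζ, X ≤
        (t ^ ((ζ : ℝ) / S.ℓ) + K * s ^ ((ζ : ℝ) / S.ℓ) * (t - s) ^ (-b / S.ℓ)) *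
          ‖Λ - Λ'‖ + K * C * s ^ (γ / S.ℓ) * (t - s) ^ (-b / S.ℓ) := by
      intro Λ'
      induction Λ' using UniformSpace.Completion.induction_on with
      | hp =>
        exact isClosed_le continuous_const ((continuous_const.mul
          (continuous_const.sub continuous_id).norm).add continuous_const)
      | ih f => exact hpre f
    simpa using hall Λ
  -- Here `(t - s)^{-b/ℓ}` stays bounded because `t > 0`, while `s^{γ/ℓ} → 0` because `γ > 0`.
  have hlim : Tendsto (fun s : ℝ => K * C * s ^ (γ / S.ℓ) * (t - s) ^ (-b / S.ℓ))
      (𝓝[>] 0) (𝓝 0) := by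
    have h1 : ContinuousAt (fun s : ℝ => K * C * s ^ (γ / S.ℓ) * (t - s) ^ (-b / S.ℓ)) 0 := by
      refine (continuousAt_const.mul (Real.continuousAt_rpow_const 0 _
        (Or.inr (div_nonneg hγ.le S.ℓ_pos.le)))).mul ?_
      exact (continuousAt_const.sub continuousAt_id).rpow_const
        (Or.inl (by simpa using ht.1.ne'))
    have h2 := h1.tendsto.mono_left (nhdsWithin_le_nhds (s := Ioi 0))
    simpa [Real.zero_rpow (div_pos hγ S.ℓ_pos).ne'] using h2
  have hX0 : X ≤ 0 := by
    refine ge_of_tendsto hlim ?_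
    filter_upwards [Ioo_mem_nhdsGT ht.1] with s hs
    exact key s hs.1 hs.2
  have : |Besov.act t x Λ - Q.act t x F| ≤ 0 := by
    by_contra! h
    exact absurd hX0 (not_le.2 (mul_pos hux h))
  exact sub_eq_zero.1 (abs_nonpos_iff.1 this)

lemma aestronglyMeasurable_of_continuousOn {F : Pt d → ℝ}
    (hF : ContinuousOn F {x | x 0 ≠ 0}) : AEStronglyMeasurable F := by
  have ho : IsOpen {x : Pt d | x 0 ≠ 0} := isOpen_ne_fun (continuous_apply 0) continuous_const
  have h := hF.aestronglyMeasurable ho.measurableSet (μ := volume)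
  rwa [Measure.restrict_eq_self_of_ae_mem
    (show ∀ᵐ x : Pt d, x ∈ {x | x 0 ≠ 0} from ae_ne_zero)] at h

/-- A function which is continuous off the hyperplane `x_1 = 0` with a singularity `φ^{-a}`
defines an element of `C^{ζ,Q}(u)` for `ζ < -a`. -/
lemma exists_isRealizedBy {a : ℝ} (ha : 0 ≤ a) (ha1 : a < S.s 0) (hζ : (ζ : ℝ) < -a)
    {F : Pt d → ℝ} (hFc : ContinuousOn F {x | x 0 ≠ 0}) {M : ℝ} (hM : 0 ≤ M)
    (hF : ∀ y, y 0 ≠ 0 → u.val y * |F y| ≤ M * S.phi y ^ (-a)) :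
    ∃ Λ : Besov Q u ζ, IsRealizedBy Λ F := by
  have hFm := aestronglyMeasurable_of_continuousOn hFc
  have ho : IsOpen {x : Pt d | x 0 ≠ 0} := isOpen_ne_fun (continuous_apply 0) continuous_const
  -- A spare power of `φ`: `a + ε < s_1` keeps the singularity integrable, and `a + ε ≤ -ζ` keeps
  -- `t^{-ζ/ℓ} t^{-(a+ε)/ℓ} ≤ 1`.
  obtain ⟨ε, hε, hε1, hε2⟩ : ∃ ε : ℝ, 0 < ε ∧ a + ε < S.s 0 ∧ a + ε ≤ -ζ :=
    ⟨min ((S.s 0 - a) / 2) (-ζ - a), lt_min (by linarith) (by linarith),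
      by linarith [min_le_left ((S.s 0 - a) / 2) (-ζ - a)],
      by linarith [min_le_right ((S.s 0 - a) / 2) (-ζ - a)]⟩
  obtain ⟨Ka, hKa0, hKa⟩ := Q.exists_singular_bound u ha ha1
  obtain ⟨K, hK0, hK⟩ := Q.exists_singular_bound u (by linarith : 0 ≤ a + ε) hε1
  have hint : ∀ t ∈ Ioc (0 : ℝ) 1, ∀ x, Integrable fun y => Q.Q t x y * F y :=
    fun t ht x => (hKa t ht x F M hM hF).1 hFm
  -- A continuous cutoff, zero where `φ ≤ 1/(n+1)` and one where `φ ≥ 2/(n+1)`.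
  set χ : ℕ → Pt d → ℝ := fun n x => max 0 (min 1 ((n + 1) * S.phi x - 1)) with hχ
  have hχ0 : ∀ n x, 0 ≤ χ n x := fun n x => le_max_left _ _
  have hχ1 : ∀ n x, χ n x ≤ 1 := fun n x => max_le zero_le_one (min_le_left _ _)
  have hχc : ∀ n, Continuous (χ n) := fun n =>
    continuous_const.max (continuous_const.min
      ((continuous_const.mul S.continuous_phi).sub continuous_const))
  have hχz : ∀ (n : ℕ) x, (n + 1 : ℝ) * S.phi x ≤ 1 → χ n x = 0 := fun n x h =>
    max_eq_left ((min_le_right _ _).trans (by linarith))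
  have hχo : ∀ (n : ℕ) x, 2 ≤ (n + 1 : ℝ) * S.phi x → χ n x = 1 := fun n x h => by
    simp only [hχ]
    rw [min_eq_left (by linarith), max_eq_right zero_le_one]
  have hphi0 : ∀ x : Pt d, x 0 = 0 → S.phi x = 0 := fun x hx => by
    simp [Setting.phi, hx, Real.zero_rpow (inv_pos.2 (S.s_pos 0)).ne']
  have hmem : ∀ n, (fun x => χ n x * F x) ∈ CW u := by
    intro n
    have hn : (0 : ℝ) < n + 1 := by positivity
    refine ⟨continuous_iff_continuousAt.2 fun x => ?_, M * ((n + 1 : ℝ)⁻¹) ^ (-a), fun x => ?_⟩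
    · by_cases hx : x 0 = 0
      · have h1 : ∀ᶠ y in 𝓝 x, (n + 1 : ℝ) * S.phi y < 1 := by
          have hc : Continuous fun y => (n + 1 : ℝ) * S.phi y :=
            continuous_const.mul S.continuous_phi
          refine hc.continuousAt.eventually_lt_const ?_
          simp [hphi0 x hx]
        refine ContinuousAt.congr (f := fun _ => (0 : ℝ)) continuousAt_const ?_
        filter_upwards [h1] with y hy
        rw [hχz n y hy.le, zero_mul]
      · exact (hχc n).continuousAt.mul (hFc.continuousAt (ho.mem_nhds hx))
    · have hRHS : 0 ≤ M * ((n + 1 : ℝ)⁻¹) ^ (-a) := by positivity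
      change u.val x * |χ n x * F x| ≤ _
      rcases le_or_gt ((n + 1 : ℝ) * S.phi x) 1 with h | h
      · rw [hχz n x h, zero_mul, abs_zero, mul_zero]
        exact hRHS
      · have hx : x 0 ≠ 0 := fun h0 => by
          rw [hphi0 x h0, mul_zero] at h; linarith
        rw [abs_mul, abs_of_nonneg (hχ0 n x)]
        calc _ = χ n x * (u.val x * |F x|) := by ring
          _ ≤ 1 * (M * S.phi x ^ (-a)) :=
            mul_le_mul (hχ1 n x) (hF x hx) (mul_nonneg (u.val_pos x).le (abs_nonneg _))
              zero_le_one
          _ ≤ _ := by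
            rw [one_mul]
            refine mul_le_mul_of_nonneg_left ?_ hM
            refine Real.rpow_le_rpow_of_nonpos (inv_pos.2 hn) ?_ (by linarith)
            rw [inv_le_iff_one_le_mul₀' hn]
            exact h.le
  -- Where `χ n ≠ 1` one has `φ < 2/(n+1)`, hence `φ^{-a} ≤ δ n * φ^{-(a+ε)}`: the spare power
  -- becomes the rate of convergence.
  set δ : ℕ → ℝ := fun n => (2 / (n + 1 : ℝ)) ^ ε with hδ
  have hδ0 : ∀ n, 0 ≤ δ n := fun n => by simp only [hδ]; positivity
  let Fn : ℕ → BesovPre Q u ζ := fun n => (⟨fun x => χ n x * F x, hmem n⟩ : CW u)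
  have hFn : ∀ n, (Fn n).fn = fun x => χ n x * F x := fun n => rfl
  have hdiff : ∀ n y, y 0 ≠ 0 →
      u.val y * |(Fn n).fn y - F y| ≤ M * δ n * S.phi y ^ (-(a + ε)) := by
    intro n y hy
    have hn : (0 : ℝ) < n + 1 := by positivity
    have hp := S.phi_pos hy
    have hRHS : 0 ≤ M * δ n * S.phi y ^ (-(a + ε)) :=
      mul_nonneg (mul_nonneg hM (hδ0 n)) (Real.rpow_nonneg hp.le _)
    rw [hFn]
    rcases le_or_gt 2 ((n + 1 : ℝ) * S.phi y) with h | h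
    · simpa [hχo n y h] using hRHS
    · have h1 : |χ n y * F y - F y| ≤ |F y| := by
        have : χ n y * F y - F y = -((1 - χ n y) * F y) := by ring
        rw [this, abs_neg, abs_mul, abs_of_nonneg (sub_nonneg.2 (hχ1 n y))]
        exact mul_le_of_le_one_left (abs_nonneg _) (by linarith [hχ0 n y])
      have h2 : S.phi y ^ ε ≤ δ n := by
        refine Real.rpow_le_rpow hp.le ?_ hε.le
        rw [le_div_iff₀ hn, mul_comm]
        exact h.le
      calc _ ≤ u.val y * |F y| := mul_le_mul_of_nonneg_left h1 (u.val_pos y).le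
        _ ≤ M * S.phi y ^ (-a) := hF y hy
        _ = M * S.phi y ^ ε * S.phi y ^ (-(a + ε)) := by
          rw [mul_assoc, ← Real.rpow_add hp]; ring_nf
        _ ≤ _ := mul_le_mul_of_nonneg_right (mul_le_mul_of_nonneg_left h2 hM)
          (Real.rpow_nonneg hp.le _)
  have hact : ∀ n, ∀ t ∈ Ioc (0 : ℝ) 1, ∀ x,
      t ^ (-(ζ : ℝ) / S.ℓ) * (u.val x * |Q.act t x (Fn n).fn - Q.act t x F|) ≤ K * M * δ n := by
    intro n t ht x
    have h1 := (Q.abs_act_le u t x _).trans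
      (hK t ht x _ _ (mul_nonneg hM (hδ0 n)) (hdiff n)).2
    have he : Q.act t x (fun y => (Fn n).fn y - F y) = Q.act t x (Fn n).fn - Q.act t x F :=
      Q.act_sub (Q.integrable_act u ht x (Fn n)) (hint t ht x)
    rw [he] at h1
    have h2 : t ^ (-(ζ : ℝ) / S.ℓ) * t ^ (-(a + ε) / S.ℓ) ≤ 1 := by
      rw [← Real.rpow_add ht.1]
      refine Real.rpow_le_one ht.1.le ht.2 ?_
      rw [← add_div]
      exact div_nonneg (by linarith) S.ℓ_pos.le
    have h3 : 0 ≤ K * M * δ n := mul_nonneg (mul_nonneg hK0 hM) (hδ0 n)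
    calc _ ≤ t ^ (-(ζ : ℝ) / S.ℓ) * (K * (M * δ n) * t ^ (-(a + ε) / S.ℓ)) :=
          mul_le_mul_of_nonneg_left h1 (Real.rpow_nonneg ht.1.le _)
      _ = K * M * δ n * (t ^ (-(ζ : ℝ) / S.ℓ) * t ^ (-(a + ε) / S.ℓ)) := by ring
      _ ≤ _ := mul_le_of_le_one_right h3 h2
  have hδlim : Tendsto δ atTop (𝓝 0) := by
    have h1 : Tendsto (fun n : ℕ => 2 / (n + 1 : ℝ)) atTop (𝓝 0) := by
      have := (tendsto_one_div_add_atTop_nhds_zero_nat (𝕜 := ℝ)).const_mul 2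
      simpa [div_eq_mul_inv] using this
    have h2 := h1.rpow_const (Or.inr hε.le : (0 : ℝ) ≠ 0 ∨ 0 ≤ ε)
    rwa [Real.zero_rpow hε.ne'] at h2
  have hδanti : ∀ N n, N ≤ n → δ n ≤ δ N := by
    intro N n h
    have : (N : ℝ) ≤ n := Nat.cast_le.2 h
    exact Real.rpow_le_rpow (by positivity) (by gcongr) hε.le
  have hcauchy : CauchySeq fun n => (Fn n : Besov Q u ζ) := by
    refine cauchySeq_of_le_tendsto_0 (fun N => 2 * (K * M) * δ N) (fun n m N hn hm => ?_) ?_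
    · rw [dist_eq_norm, ← UniformSpace.Completion.coe_sub, UniformSpace.Completion.norm_coe]
      refine BesovPre.norm_le fun t ht x => ?_
      have h1 := hact n t ht x
      have h2 := hact m t ht x
      have h3 := mul_le_mul_of_nonneg_left (hδanti N n hn) (mul_nonneg hK0 hM)
      have h4 := mul_le_mul_of_nonneg_left (hδanti N m hm) (mul_nonneg hK0 hM)
      rw [BesovPre.act_sub ht]
      have h5 : t ^ (-(ζ : ℝ) / S.ℓ) * (u.val x * |Q.act t x (Fn n).fn - Q.act t x (Fn m).fn|) ≤
          t ^ (-(ζ : ℝ) / S.ℓ) * (u.val x * (|Q.act t x (Fn n).fn - Q.act t x F| +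
            |Q.act t x (Fn m).fn - Q.act t x F|)) := by
        refine mul_le_mul_of_nonneg_left (mul_le_mul_of_nonneg_left ?_ (u.val_pos x).le)
          (Real.rpow_nonneg ht.1.le _)
        rw [abs_sub_comm (Q.act t x (Fn m).fn)]
        exact abs_sub_le _ _ _
      rw [mul_add, mul_add] at h5
      linarith
    · simpa using hδlim.const_mul (2 * (K * M))
  obtain ⟨Λ, hΛ⟩ := cauchySeq_tendsto_of_complete hcauchy
  refine ⟨Λ, fun t ht x => ⟨hint t ht x, ?_⟩⟩
  have h1 := ((Besov.continuous_act t x).tendsto Λ).comp hΛ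
  refine tendsto_nhds_unique h1 ?_
  have hc : 0 < t ^ (-(ζ : ℝ) / S.ℓ) * u.val x :=
    mul_pos (Real.rpow_pos_of_pos ht.1 _) (u.val_pos x)
  rw [tendsto_iff_dist_tendsto_zero]
  refine squeeze_zero (fun _ => dist_nonneg) (fun n => ?_)
    (g := fun n => (t ^ (-(ζ : ℝ) / S.ℓ) * u.val x)⁻¹ * (K * M * δ n)) ?_
  · rw [← div_eq_inv_mul, le_div_iff₀ hc, mul_comm, Function.comp_apply,
      Besov.act_coe Q u ζ ht, Real.dist_eq, mul_assoc]
    exact hact n t ht x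
  · simpa using (hδlim.const_mul (K * M)).const_mul (t ^ (-(ζ : ℝ) / S.ℓ) * u.val x)⁻¹

end BesovSpace

/-! ### The diagonal of the model and the function `F` -/

section Reconstruction

variable {d : ℕ} {S : Setting d} {Q : GSemigroup S} {w : GWeight S} {R : RegularityStructure}

/-- As `t ↓ 0`, `Q_t(x, Π_x τ)` tends to the value at `x` by continuity of `Π_x τ`, and to `0` by
the model bound `t^{α/ℓ}`. -/
lemma SmoothModel.diag_eq_zero (M : SmoothModel Q w R) {α : R.A} (hα : 0 < (α : ℝ)) (x : Pt d)
    (τ : R.T α) : (M.Pi x (R.incl α τ) : Pt d → ℝ) x = 0 := by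
  obtain ⟨C, hC⟩ := M.Pi_bound (α + 1)
  have hwx := w.val_pos x
  have h1 := Q.tendsto_act (M.Pi x (R.incl α τ)) x
  refine tendsto_nhds_unique h1 ?_
  have hlim : Tendsto (fun t : ℝ => (w.val x)⁻¹ * (C * ‖τ‖) * t ^ ((α : ℝ) / S.ℓ))
      (𝓝[>] 0) (𝓝 0) := by
    have hc := ((Real.continuousAt_rpow_const 0 ((α : ℝ) / S.ℓ)
      (Or.inr (div_nonneg hα.le S.ℓ_pos.le))).tendsto.const_mul
        ((w.val x)⁻¹ * (C * ‖τ‖))).mono_left (nhdsWithin_le_nhds (s := Ioi 0))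
    rwa [Real.zero_rpow (div_pos hα S.ℓ_pos).ne', mul_zero] at hc
  refine squeeze_zero_norm' ?_ hlim
  filter_upwards [Ioc_mem_nhdsGT (zero_lt_one (α := ℝ))] with t ht
  have h2 := hC α (by linarith) t ht x τ
  have htα := Real.rpow_pos_of_pos ht.1 ((α : ℝ) / S.ℓ)
  rw [neg_div, Real.rpow_neg ht.1.le] at h2
  rw [Real.norm_eq_abs]
  calc _ = (w.val x)⁻¹ * ((t ^ ((α : ℝ) / S.ℓ))⁻¹ * w.val x *
        |Q.act t x (M.Pi x (R.incl α τ))|) * t ^ ((α : ℝ) / S.ℓ) := by field_simp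
    _ ≤ _ := by gcongr

lemma RegularityStructure.map_eq_sum (R : RegularityStructure) (L : R.Mod →ₗ[ℝ] ℝ)
    (A : Finset R.A) (h : ∀ α ∉ A, ∀ τ : R.T α, L (R.incl α τ) = 0) (τ : R.Mod) :
    L τ = ∑ α ∈ A, L (R.incl α (τ α)) := by
  induction τ using DirectSum.induction_on with
  | zero => simp
  | of β σ =>
    by_cases hβ : β ∈ A
    · rw [Finset.sum_eq_single_of_mem β hβ fun α _ hne => by
        rw [DirectSum.of_eq_of_ne _ _ _ hne, map_zero, map_zero], DirectSum.of_eq_same]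
      rfl
    · rw [Finset.sum_eq_zero fun α hα => by
        rw [DirectSum.of_eq_of_ne _ _ _ (ne_of_mem_of_not_mem hα hβ), map_zero, map_zero]]
      exact h β hβ σ
  | add σ τ hσ hτ =>
    rw [map_add, hσ, hτ, ← Finset.sum_add_distrib]
    simp [DirectSum.add_apply]

/-- On the diagonal, `Π` only sees the components of nonpositive degree. -/
lemma SmoothModel.exists_diag_bound (M : SmoothModel Q w R)
    (hM : ∀ α : R.A, ∃ C : ℝ, ∀ (x : Pt d) (τ : R.T α),
      w.val x * |(M.Pi x (R.incl α τ) : Pt d → ℝ) x| ≤ C * ‖τ‖) :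
    ∃ A : Finset R.A, (∀ α ∈ A, (α : ℝ) ≤ 0) ∧ ∃ C : ℝ, 0 ≤ C ∧ ∀ (x : Pt d) (τ : R.Mod),
      w.val x * |(M.Pi x τ : Pt d → ℝ) x| ≤ C * ∑ α ∈ A, ‖τ α‖ := by
  -- Nonpositive degrees lie in `[α₀, 0]`, where local finiteness applies.
  have hfin : {α : R.A | (α : ℝ) ≤ 0}.Finite := by
    refine Set.Finite.of_finite_image ((R.locallyFinite R.α₀ 0).subset ?_)
      Subtype.val_injective.injOn
    rintro _ ⟨α, hα, rfl⟩
    exact ⟨α.2, R.isLeast.2 α.2, hα⟩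
  choose C hC using hM
  refine ⟨hfin.toFinset, fun α hα => hfin.mem_toFinset.1 hα,
    ∑ α ∈ hfin.toFinset, |C α|, Finset.sum_nonneg fun α _ => abs_nonneg _, fun x τ => ?_⟩
  let L : R.Mod →ₗ[ℝ] ℝ :=
    (LinearMap.proj x : (Pt d → ℝ) →ₗ[ℝ] ℝ) ∘ₗ (CW w).subtype ∘ₗ M.Pi x
  have hL : ∀ σ, (M.Pi x σ : Pt d → ℝ) x = L σ := fun σ => rfl
  rw [hL, R.map_eq_sum L hfin.toFinset (fun α hα σ => M.diag_eq_zero (by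
    rw [hfin.mem_toFinset] at hα; exact not_le.1 hα) x σ) τ, Finset.mul_sum]
  calc _ ≤ w.val x * ∑ α ∈ hfin.toFinset, |L (R.incl α (τ α))| :=
        mul_le_mul_of_nonneg_left (Finset.abs_sum_le_sum_abs _ _) (w.val_pos x).le
    _ = ∑ α ∈ hfin.toFinset, w.val x * |L (R.incl α (τ α))| := Finset.mul_sum _ _ _
    _ ≤ _ := by
        refine Finset.sum_le_sum fun α hα => ((hC α x (τ α)).trans ?_)
        refine mul_le_mul_of_nonneg_right ((le_abs_self _).trans ?_) (norm_nonneg _)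
        exact Finset.single_le_sum (f := fun α => |C α|) (fun β _ => abs_nonneg _) hα

variable [NeZero d] {v wv : GWeight S} {M : SmoothModel Q w R} {γ η : ℝ} {f : Pt d → R.Mod}
  {A : Finset R.A} {C₀ : ℝ}

/-- For `α ≤ 0` and `φ ≤ 1`, the singularity `φ^{(η-α) ∧ 0}` is no worse than `φ^{η ∧ 0}`. The
double negation matches the form `φ^{-a}` with `a = -(η ∧ 0)`. -/
lemma MemDSharp.exists_diag_bound (hf : MemDSharp v M γ η f)
    (hwv : ∀ x, wv.val x = w.val x * v.val x) (hγ : 0 < γ)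
    (hA : ∀ α ∈ A, (α : ℝ) ≤ 0) (hC₀ : 0 ≤ C₀)
    (hdiag : ∀ (x : Pt d) (τ : R.Mod),
      w.val x * |(M.Pi x τ : Pt d → ℝ) x| ≤ C₀ * ∑ α ∈ A, ‖τ α‖) :
    ∃ N : ℝ, 0 ≤ N ∧ ∀ x, x 0 ≠ 0 →
      wv.val x * |(M.Pi x (f x) : Pt d → ℝ) x| ≤ N * S.phi x ^ (-(-(min η 0))) := by
  obtain ⟨C, hC⟩ := hf.bound
  refine ⟨C₀ * (A.card * |C|), by positivity, fun x hx => ?_⟩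
  have hvx := v.val_pos x
  rw [neg_neg]
  calc _ = v.val x * (w.val x * |(M.Pi x (f x) : Pt d → ℝ) x|) := by rw [hwv]; ring
    _ ≤ v.val x * (C₀ * ∑ α ∈ A, ‖f x α‖) := mul_le_mul_of_nonneg_left (hdiag x _) hvx.le
    _ = C₀ * ∑ α ∈ A, v.val x * ‖f x α‖ := by rw [← Finset.mul_sum]; ring
    _ ≤ C₀ * ∑ α ∈ A, |C| * S.phi x ^ (min η 0) := by
        refine mul_le_mul_of_nonneg_left (Finset.sum_le_sum fun α hα => ?_) hC₀
        have hα0 := hA α hα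
        have h1 : S.phi x ^ (min (η - α) 0) ≤ S.phi x ^ (min η 0) :=
          Real.rpow_le_rpow_of_exponent_ge (S.phi_pos hx) (S.phi_le_one x)
            (min_le_min_right 0 (by linarith))
        refine (hC α (by linarith) x hx).trans ?_
        exact mul_le_mul (le_abs_self C) h1 (Real.rpow_nonneg (S.phi_nonneg x) _) (abs_nonneg _)
    _ = _ := by rw [Finset.sum_const, nsmul_eq_mul]; ring

/-- Since `Π_x f(x) = Π_y Γ_{yx} f(x)`, the difference is a diagonal value at the base point `y`, so
the diagonal bound applies to the increment `f(y) - Γ_{yx} f(x)`. The weight `w` is moved to `y`,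
whereas `v` stays at `x`, as the increment bound requires. -/
lemma MemDSharp.exists_diff_bound (hf : MemDSharp v M γ η f)
    (hwv : ∀ x, wv.val x = w.val x * v.val x)
    (hwv_star : ∀ x, wv.star x = w.star x * v.star x) (hγ : 0 < γ)
    (hA : ∀ α ∈ A, (α : ℝ) ≤ 0) (hC₀ : 0 ≤ C₀)
    (hdiag : ∀ (x : Pt d) (τ : R.Mod),
      w.val x * |(M.Pi x τ : Pt d → ℝ) x| ≤ C₀ * ∑ α ∈ A, ‖τ α‖) :
    ∃ N : ℝ, 0 ≤ N ∧ ∀ x y, x 0 ≠ 0 → y 0 ≠ 0 →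
      wv.val x * |(M.Pi y (f y) : Pt d → ℝ) y - (M.Pi x (f x) : Pt d → ℝ) y| ≤
        N * (S.phi₂ x y ^ (-(γ - η)) *
          (wv.star (x - y) * ∑ α ∈ A, S.anorm (x - y) ^ (γ - (α : ℝ)))) := by
  obtain ⟨C, hC⟩ := hf.bound_diff
  refine ⟨C₀ * |C|, by positivity, fun x y hx hy => ?_⟩
  have hphi : 0 ≤ S.phi₂ x y ^ (-(γ - η)) :=
    Real.rpow_nonneg (le_min (S.phi_nonneg x) (S.phi_nonneg y)) _
  have hws : 0 ≤ w.star (x - y) := zero_le_one.trans (w.one_le_star _)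
  have hvs : 0 ≤ v.star (x - y) := zero_le_one.trans (v.one_le_star _)
  have hws' : 0 ≤ wv.star (x - y) := zero_le_one.trans (wv.one_le_star _)
  have han : ∀ α : R.A, 0 ≤ S.anorm (x - y) ^ (γ - (α : ℝ)) := fun α =>
    Real.rpow_nonneg (S.anorm_nonneg _) _
  rcases eq_or_ne x y with rfl | hne
  · rw [sub_self, abs_zero, mul_zero]
    exact mul_nonneg (by positivity) (mul_nonneg hphi (mul_nonneg hws'
      (Finset.sum_nonneg fun α _ => han α)))
  set σ := f y - M.Γ y x (f x) with hσ
  have heq : (M.Pi y (f y) : Pt d → ℝ) y - (M.Pi x (f x) : Pt d → ℝ) y =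
      (M.Pi y σ : Pt d → ℝ) y := by
    rw [hσ, map_sub, M.Pi_Γ]; rfl
  have hvx := v.val_pos x
  have hwx := w.val_le x y
  rw [heq]
  calc _ = v.val x * (w.val x * |(M.Pi y σ : Pt d → ℝ) y|) := by rw [hwv]; ring
    _ ≤ v.val x * (w.star (x - y) * w.val y * |(M.Pi y σ : Pt d → ℝ) y|) := by gcongr
    _ = v.val x * w.star (x - y) * (w.val y * |(M.Pi y σ : Pt d → ℝ) y|) := by ring
    _ ≤ v.val x * w.star (x - y) * (C₀ * ∑ α ∈ A, ‖σ α‖) :=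
        mul_le_mul_of_nonneg_left (hdiag y σ) (mul_nonneg hvx.le hws)
    _ = C₀ * w.star (x - y) * ∑ α ∈ A, v.val x * ‖σ α‖ := by rw [← Finset.mul_sum]; ring
    _ ≤ C₀ * w.star (x - y) * ∑ α ∈ A, |C| * (S.phi₂ x y ^ (-(γ - η)) * v.star (x - y) *
          S.anorm (x - y) ^ (γ - (α : ℝ))) := by
        refine mul_le_mul_of_nonneg_left (Finset.sum_le_sum fun α hα => ?_)
          (mul_nonneg hC₀ hws)
        have hα0 := hA α hα
        refine (hC α (by linarith) x y hx hy hne).trans ?_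
        rw [neg_sub, ← neg_sub x y, S.anorm_neg]
        rw [neg_sub] at hphi
        exact mul_le_mul_of_nonneg_right (le_abs_self C)
          (mul_nonneg (mul_nonneg hphi hvs) (han α))
    _ = _ := by
        rw [hwv_star, ← Finset.mul_sum, ← Finset.mul_sum]; ring

/-- Near `x`, `F` is the continuous function `Π_x f(x)` plus an error that vanishes as `y → x`: all
exponents `γ - α` are positive, and `φ(x,y)` stays away from zero. -/
lemma continuousOn_diag (hA : ∀ α ∈ A, (α : ℝ) < γ) {N : ℝ}
    (hN : ∀ x y, x 0 ≠ 0 → y 0 ≠ 0 →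
      wv.val x * |(M.Pi y (f y) : Pt d → ℝ) y - (M.Pi x (f x) : Pt d → ℝ) y| ≤
        N * (S.phi₂ x y ^ (-(γ - η)) *
          (wv.star (x - y) * ∑ α ∈ A, S.anorm (x - y) ^ (γ - (α : ℝ))))) :
    ContinuousOn (fun x => (M.Pi x (f x) : Pt d → ℝ) x) {x | x 0 ≠ 0} := by
  have ho : IsOpen {x : Pt d | x 0 ≠ 0} := isOpen_ne_fun (continuous_apply 0) continuous_const
  refine fun x hx => ContinuousAt.continuousWithinAt ?_
  have hux := wv.val_pos x
  have hsub : Continuous fun y : Pt d => x - y := continuous_const.sub continuous_id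
  have hg : ContinuousAt (fun y => (wv.val x)⁻¹ * (N * (S.phi₂ x y ^ (-(γ - η)) *
      (wv.star (x - y) * ∑ α ∈ A, S.anorm (x - y) ^ (γ - (α : ℝ)))))) x := by
    refine continuousAt_const.mul (continuousAt_const.mul (ContinuousAt.mul ?_ ?_))
    · have h1 : Continuous (S.phi₂ x) := continuous_const.min S.continuous_phi
      refine h1.continuousAt.rpow_const (Or.inl ?_)
      simpa [Setting.phi₂] using (S.phi_pos hx).ne'
    · refine ((wv.continuous_star.comp hsub).mul
        (continuous_finsetSum _ fun α hα => ?_)).continuousAt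
      exact (S.continuous_anorm.comp hsub).rpow_const
        fun _ => Or.inr (by linarith [hA α hα])
  have hg0 : (wv.val x)⁻¹ * (N * (S.phi₂ x x ^ (-(γ - η)) *
      (wv.star (x - x) * ∑ α ∈ A, S.anorm (x - x) ^ (γ - (α : ℝ))))) = 0 := by
    rw [Finset.sum_eq_zero fun α hα => by
      rw [sub_self, S.anorm_zero, Real.zero_rpow (by linarith [hA α hα])]]
    simp
  have hlim := hg.tendsto
  rw [hg0] at hlim
  have h1 : Tendsto (fun y => (M.Pi y (f y) : Pt d → ℝ) y - (M.Pi x (f x) : Pt d → ℝ) y)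
      (𝓝 x) (𝓝 0) := by
    refine squeeze_zero_norm' ?_ hlim
    filter_upwards [ho.mem_nhds hx] with y hy
    rw [Real.norm_eq_abs, ← div_eq_inv_mul, le_div_iff₀ hux, mul_comm]
    exact hN x y hx hy
  have h2 := h1.add ((M.Pi x (f x)).2.1.tendsto x)
  simpa [ContinuousAt] using h2

/-- A bound in the form required of a reconstruction. -/
lemma weighted_le_iff {t p a X C : ℝ} (ht : 0 < t) (hp : 0 < p) {b l : ℝ} :
    t ^ (-b / l) * p ^ a * X ≤ C ↔ X ≤ C * t ^ (b / l) * p ^ (-a) := by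
  have h1 := Real.rpow_pos_of_pos ht (b / l)
  have h2 := Real.rpow_pos_of_pos hp a
  rw [neg_div, Real.rpow_neg ht.le, Real.rpow_neg hp.le]
  constructor
  · intro h
    calc X = (t ^ (b / l))⁻¹ * p ^ a * X * t ^ (b / l) * (p ^ a)⁻¹ := by field_simp
      _ ≤ _ := by gcongr
  · intro h
    calc _ ≤ (t ^ (b / l))⁻¹ * p ^ a * (C * t ^ (b / l) * (p ^ a)⁻¹) := by gcongr
      _ = C := by field_simp

end Reconstruction

end SingularMD

/-! ### The proposition -/

open SingularMD
theorem mainTheorem11 {d : ℕ} [NeZero d] (S : Setting d) (Q : GSemigroup S)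
    (w v wv : GWeight S) (hwv : ∀ x, wv.val x = w.val x * v.val x)
    (hwv_star : ∀ x, wv.star x = w.star x * v.star x)
    (R : RegularityStructure) (M : SmoothModel Q w R)
    (hM : ∀ α : R.A, ∃ C : ℝ, ∀ (x : Pt d) (τ : R.T α),
      w.val x * |(M.Pi x (R.incl α τ) : Pt d → ℝ) x| ≤ C * ‖τ‖)
    (γ η : ℝ) (hγ : 0 < γ) (hη : γ - S.s 0 < η) (hηγ : η ≤ γ)
    (f : Pt d → R.Mod) (hf : MemDSharp v M γ η f) :
    ContinuousOn (fun x => (M.Pi x (f x) : Pt d → ℝ) x) {x | x 0 ≠ 0} ∧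
    (∀ (ζ : Set.Iic (0 : ℝ)) (Λ : Besov Q wv ζ), IsReconstruction M γ η f Λ →
      IsRealizedBy Λ (fun x => (M.Pi x (f x) : Pt d → ℝ) x) ∧
      ∃ C : ℝ, ∀ t ∈ Set.Ioc (0 : ℝ) 1, ∀ x : Pt d,
        t ^ (-(min (min η R.α₀) 0) / S.ℓ) * (wv.val x * |Besov.act t x Λ|) ≤ C) ∧
    (∀ ζ : Set.Iic (0 : ℝ), (ζ : ℝ) < min η 0 →
      ∃! Λ : Besov Q wv ζ, IsReconstruction M γ η f Λ) := by
  obtain ⟨A, hA, C₀, hC₀, hdiag⟩ := M.exists_diag_bound hM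
  obtain ⟨N, hN0, hN⟩ := hf.exists_diag_bound hwv hγ hA hC₀ hdiag
  obtain ⟨D, hD0, hD⟩ := hf.exists_diff_bound hwv hwv_star hγ hA hC₀ hdiag
  have hcont := continuousOn_diag (fun α hα => (hA α hα).trans_lt hγ) hD
  set F : Pt d → ℝ := fun x => (M.Pi x (f x) : Pt d → ℝ) x with hF
  have hFm := aestronglyMeasurable_of_continuousOn hcont
  have ha : 0 ≤ -(min η 0) := neg_nonneg.2 (min_le_right _ _)
  have ha1 : -(min η 0) < S.s 0 := by
    have := S.s_pos 0
    rw [neg_lt]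
    exact lt_min (by linarith) (by linarith)
  have hb : 0 ≤ γ - η := sub_nonneg.2 hηγ
  have hb1 : γ - η < S.s 0 := by linarith
  obtain ⟨Ka, hKa0, hKa⟩ := Q.exists_singular_bound wv ha ha1
  obtain ⟨K, hK0, hK⟩ := Q.exists_local_bound wv A (fun α => γ - (α : ℝ)) hγ.le
    (fun α hα => by linarith [hA α hα]) hb hb1
  -- `F` itself obeys the reconstruction bound; the decay is `t^{γ/ℓ}` because every exponent
  -- satisfies `γ - α ≥ γ`.
  have hrec : ∀ t ∈ Set.Ioc (0 : ℝ) 1, ∀ x : Pt d, x 0 ≠ 0 →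
      wv.val x * |Q.act t x F - Q.act t x (M.Pi x (f x))| ≤
        K * D * t ^ (γ / S.ℓ) * S.phi x ^ (-(γ - η)) := by
    intro t ht x hx
    have h := hK t ht x hx (fun y => F y - (M.Pi x (f x) : Pt d → ℝ) y) D hD0
      fun y hy => hD x y hx hy
    rwa [Q.act_sub ((hKa t ht x F N hN0 hN).1 hFm) (Q.integrable_act w ht x _)] at h
  have hreal : ∀ (ζ : Set.Iic (0 : ℝ)) (Λ : Besov Q wv ζ), IsReconstruction M γ η f Λ →
      IsRealizedBy Λ F := by
    rintro ζ Λ ⟨C, hC⟩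
    refine isRealizedBy_of_asymptotic ha ha1 hb hb1 hγ hFm hN0 hN (C := |C| + K * D)
      (by positivity) fun t ht x hx => ?_
    have h1 := hC t ht x hx
    rw [mul_assoc _ (wv.val x), weighted_le_iff ht.1 (S.phi_pos hx)] at h1
    have h2 := hrec t ht x hx
    have htp : 0 ≤ t ^ (γ / S.ℓ) * S.phi x ^ (-(γ - η)) :=
      mul_nonneg (Real.rpow_nonneg ht.1.le _) (Real.rpow_nonneg (S.phi_nonneg x) _)
    have h3 := mul_le_mul_of_nonneg_right (le_abs_self C) htp
    have h4 := mul_le_mul_of_nonneg_left (abs_sub_le (Besov.act t x Λ)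
      (Q.act t x (M.Pi x (f x))) (Q.act t x F)) (wv.val_pos x).le
    rw [abs_sub_comm (Q.act t x (M.Pi x (f x))), mul_add] at h4
    linarith
  refine ⟨hcont, fun ζ Λ hΛ => ⟨hreal ζ Λ hΛ, Ka * N, fun t ht x => ?_⟩, fun ζ hζ => ?_⟩
  · rw [(hreal ζ Λ hΛ t ht x).2]
    have h1 := (Q.abs_act_le wv t x F).trans (hKa t ht x F N hN0 hN).2
    -- The singular bound gives the exponent `η ∧ 0`; the stated one is smaller or equal, hence
    -- weaker for `t ≤ 1`.
    have h2 : t ^ (-(min (min η R.α₀) 0) / S.ℓ) * t ^ (-(-(min η 0)) / S.ℓ) ≤ 1 := by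
      rw [← Real.rpow_add ht.1, ← add_div, neg_neg]
      refine Real.rpow_le_one ht.1.le ht.2 (div_nonneg ?_ S.ℓ_pos.le)
      have : min (min η R.α₀) 0 ≤ min η 0 := min_le_min_right 0 (min_le_left _ _)
      linarith
    calc _ ≤ t ^ (-(min (min η R.α₀) 0) / S.ℓ) * (Ka * N * t ^ (-(-(min η 0)) / S.ℓ)) :=
          mul_le_mul_of_nonneg_left h1 (Real.rpow_nonneg ht.1.le _)
      _ = Ka * N * (t ^ (-(min (min η R.α₀) 0) / S.ℓ) * t ^ (-(-(min η 0)) / S.ℓ)) := by ring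
      _ ≤ _ := mul_le_of_le_one_right (mul_nonneg hKa0 hN0) h2
  · obtain ⟨Λ, hΛ⟩ := exists_isRealizedBy (Q := Q) (u := wv) (ζ := ζ) ha ha1
      (by rwa [neg_neg]) hcont hN0 hN
    -- Any competitor is also realized by `F`, and an element is determined by its values `Q_t(x,
    -- ·)`.
    refine ⟨Λ, ⟨K * D, fun t ht x hx => ?_⟩, fun Λ' hΛ' => Besov.ext_act fun t ht x => ?_⟩
    · rw [mul_assoc _ (wv.val x), weighted_le_iff ht.1 (S.phi_pos hx), (hΛ t ht x).2]
      exact hrec t ht x hx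
    · rw [(hΛ t ht x).2, (hreal ζ Λ' hΛ' t ht x).2]
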